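/- For a Riemannian manifold $X$, a totally geodesic submanifold of $X$ is an (injectively) immersed submanifold $S \subseteq X$ such that for each $p \in S$ and each $v \in T_pS$ the geodesic of $X$ with initial velocity $v$ stays in $S$ for small values of the parameter. The index $i(X)$ is the minimal codimension $\dim X - \dim S$ of a connected totally geodesic submanifold $S$ of $X$ with $\dim S < \dim X$ (points, with $\dim S = 0$, are allowed). Let $M$ be a connected Riemannian symmetric space which is irreducible, i.e. for each $p \in M$ the isotropy group at $p$ of the identity component $I(M)^o$ of the isometry group of $M$ acts irreducibly on $T_pM$. Let $\Sigma$ be a connected totally geodesic submanifold of $M$ with $1 \le \dim \Sigma < \dim M$, equipped with the induced Riemannian metric. Then $i(\Sigma) \leq i(M)$. -/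

import Mathlib

open Bundle Manifold
open scoped ContDiff Manifold

namespace RiemSym

noncomputable section

/-! Throughout, a smooth Riemannian manifold of dimension `n` is a topological space `M` with a smooth
atlas modelled on `ℝⁿ` (no boundary), together with inner products on the tangent spaces which
depend smoothly on the base point. -/

section Geodesics

variable {n : ℕ} {M : Type*} [TopologicalSpace M] [ChartedSpace (EuclideanSpace ℝ (Fin n)) M]
  [RiemannianBundle (fun x : M => TangentSpace (𝓡 n) x)]

/-- The coefficients of the Riemannian metric in the chart at `x₀`: for `y` in the image of this
chart, `metricInChart x₀ y v w` is the inner product of the tangent vectors of `M` with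
coordinates `v` and `w` at the point with coordinates `y` (so `g_ij(y)` for `v = e_i`, `w = e_j`). -/
def metricInChart (x₀ : M) (y v w : EuclideanSpace ℝ (Fin n)) : ℝ :=
  inner ℝ
    (mfderiv 𝓘(ℝ, EuclideanSpace ℝ (Fin n)) (𝓡 n) (extChartAt (𝓡 n) x₀).symm y v)
    (mfderiv 𝓘(ℝ, EuclideanSpace ℝ (Fin n)) (𝓡 n) (extChartAt (𝓡 n) x₀).symm y w)

/-- The Christoffel symbols of the first kind of the Levi-Civita connection in the chart at `x₀`:
`[ij, k] = (∂_i g_jk + ∂_j g_ik - ∂_k g_ij) / 2`, for `u = e_i`, `v = e_j`, `w = e_k`. -/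
def christoffelFirst (x₀ : M) (y u v w : EuclideanSpace ℝ (Fin n)) : ℝ :=
  (fderiv ℝ (fun z => metricInChart x₀ z v w) y u
    + fderiv ℝ (fun z => metricInChart x₀ z u w) y v
    - fderiv ℝ (fun z => metricInChart x₀ z u v) y w) / 2

/-- `γ` is a geodesic (with its affine parametrization, constant curves included) on the open set
`J ⊆ ℝ`: it is of class `C²` there and satisfies the geodesic equation `∇_{γ'} γ' = 0`. In local
coordinates `u` and with lowered index this reads
`∑ i, g_ik u_i'' + ∑ i j, [ij, k] u_i' u_j' = 0` for all `k`. -/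
def IsGeodesicOn (γ : ℝ → M) (J : Set ℝ) : Prop :=
  ContMDiffOn 𝓘(ℝ, ℝ) (𝓡 n) 2 γ J ∧
  ∀ t ∈ J, ∀ w : EuclideanSpace ℝ (Fin n),
    let u : ℝ → EuclideanSpace ℝ (Fin n) := fun s => extChartAt (𝓡 n) (γ t) (γ s)
    metricInChart (γ t) (u t) (deriv (deriv u) t) w
      + christoffelFirst (γ t) (u t) (deriv u t) (deriv u t) w = 0

end Geodesics

section Isometries

variable {n : ℕ} (M : Type*) [TopologicalSpace M] [ChartedSpace (EuclideanSpace ℝ (Fin n)) M]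
  [RiemannianBundle (fun x : M => TangentSpace (𝓡 n) x)]

variable {M} in
/-- `f` preserves the Riemannian metrics: `⟨df v, df w⟩ = ⟨v, w⟩`. -/
def PreservesMetric {k : ℕ} {N : Type*} [TopologicalSpace N]
    [ChartedSpace (EuclideanSpace ℝ (Fin k)) N]
    [RiemannianBundle (fun x : N => TangentSpace (𝓡 k) x)] (f : N → M) : Prop :=
  ∀ (x : N) (v w : TangentSpace (𝓡 k) x),
    inner ℝ (mfderiv (𝓡 k) (𝓡 n) f x v) (mfderiv (𝓡 k) (𝓡 n) f x w) = inner ℝ v w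

/-- The isometry group `I(M)`, as a set of continuous self-maps of `M`: the diffeomorphisms of `M`
that preserve the Riemannian metric. As a subset of `C(M, M)` it carries the compact-open
topology. -/
def isometries : Set C(M, M) :=
  {F | ∃ φ : M ≃ₘ^∞⟮𝓡 n, 𝓡 n⟯ M, PreservesMetric (k := n) (n := n) (φ : M → M) ∧ (F : M → M) = φ}

/-- The identity component `I(M)^o` of the isometry group. -/
def identityComponent : Set C(M, M) :=
  connectedComponentIn (isometries (n := n) M) (ContinuousMap.id M)

/-- `M` is a (connected) Riemannian symmetric space: for each point `p` there is an isometry that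
fixes `p` and whose differential at `p` is `-id`. -/
def IsRiemannianSymmetric : Prop :=
  ConnectedSpace M ∧
  ∀ p : M, ∃ s ∈ isometries (n := n) M, ∀ v : TangentSpace (𝓡 n) p,
    tangentMap (𝓡 n) (𝓡 n) s ⟨p, v⟩ = ⟨p, -v⟩

/-- Irreducibility: for each point `p`, the isotropy group `K = {k ∈ I(M)^o | k p = p}` acts
irreducibly on `T_pM ≠ 0`, i.e. the only linear subspaces of `T_pM` that are invariant under `d_pk`
for all `k ∈ K` are `0` and `T_pM`. (The equation `dk (p, v) = (p, w)` in the tangent bundle says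
`k p = p` and `d_pk v = w`.) -/
def IsIrreducible : Prop :=
  ∀ p : M, Nontrivial (TangentSpace (𝓡 n) p) ∧
    ∀ W : Submodule ℝ (TangentSpace (𝓡 n) p),
      (∀ k ∈ identityComponent (n := n) M, ∀ v w : TangentSpace (𝓡 n) p, v ∈ W →
        tangentMap (𝓡 n) (𝓡 n) k ⟨p, v⟩ = ⟨p, w⟩ → w ∈ W) →
      W = ⊥ ∨ W = ⊤

end Isometries

section TotallyGeodesic

/-- The map `f : S → M` makes the manifold `S` an (immersed) totally geodesic submanifold of `M`: it
is a smooth injective immersion, and for each `p ∈ S` and each `v ∈ T_pS` the geodesic of `M` with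
initial velocity `d_pf v` stays in `S` for small values of the parameter (as a continuous curve `c`
in `S`). -/
structure IsTotallyGeodesicSubmanifold {m n : ℕ}
    {S : Type*} [TopologicalSpace S] [ChartedSpace (EuclideanSpace ℝ (Fin m)) S]
    {M : Type*} [TopologicalSpace M] [ChartedSpace (EuclideanSpace ℝ (Fin n)) M]
    [RiemannianBundle (fun x : M => TangentSpace (𝓡 n) x)] (f : S → M) : Prop where
  injective : Function.Injective f
  contMDiff : ContMDiff (𝓡 m) (𝓡 n) ∞ f
  immersion : ∀ p : S, Function.Injective (mfderiv (𝓡 m) (𝓡 n) f p)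
  geodesic : ∀ (p : S) (v : TangentSpace (𝓡 m) p), ∃ (ε : ℝ) (c : ℝ → S), 0 < ε ∧
    ContinuousOn c (Set.Ioo (-ε) ε) ∧
    IsGeodesicOn (n := n) (fun t => f (c t)) (Set.Ioo (-ε) ε) ∧
    tangentMap 𝓘(ℝ, ℝ) (𝓡 n) (fun t => f (c t)) ⟨0, (1 : ℝ)⟩
      = tangentMap (𝓡 m) (𝓡 n) f ⟨p, v⟩ ∧
    c 0 = p

/-- The codimensions of the proper (`dim S < dim M`) connected totally geodesic submanifolds `S`
of `M`. Every connected second countable manifold is diffeomorphic to one in `Type`. -/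
def totallyGeodesicCodims {n : ℕ}
    (M : Type*) [TopologicalSpace M] [ChartedSpace (EuclideanSpace ℝ (Fin n)) M]
    [RiemannianBundle (fun x : M => TangentSpace (𝓡 n) x)] : Set ℕ :=
  {d | ∃ m : ℕ, m < n ∧ d = n - m ∧
    ∃ (S : Type) (_ : TopologicalSpace S) (_ : ChartedSpace (EuclideanSpace ℝ (Fin m)) S)
      (f : S → M), IsManifold (𝓡 m) ∞ S ∧ T2Space S ∧ SecondCountableTopology S ∧
        ConnectedSpace S ∧ IsTotallyGeodesicSubmanifold (m := m) (n := n) f}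

/-- The index `i(M)`: the minimal codimension of a proper totally geodesic submanifold of `M`
(`⊤` if there is none, which happens only in dimension `0` or for the empty manifold). -/
def index {n : ℕ}
    (M : Type*) [TopologicalSpace M] [ChartedSpace (EuclideanSpace ℝ (Fin n)) M]
    [RiemannianBundle (fun x : M => TangentSpace (𝓡 n) x)] : ℕ∞ :=
  ⨅ d ∈ totallyGeodesicCodims (n := n) M, (d : ℕ∞)

end TotallyGeodesic

end

end RiemSym

/-! The proof intersects `Σ` (the manifold `N` with its immersion `f`) with a proper totally geodesic
submanifold `S` of `M`. Since `M` is homogeneous (`exists_isometry_apply_eq`), an isometry moves `S`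
so that it meets `f(N)` at a point `f q₀`. Since `M` is irreducible, a further isometry, fixing this
point, makes `N` non-tangent to `S` there: otherwise the span of the images of `T N` under the
isotropy group would be an invariant subspace that is nonzero and contained in `T S`
(`exists_isometry_not_mem`). A piece of `N ∩ S` is then a totally geodesic submanifold of `N` of
dimension `D < dim N` with `D ≥ dim N + dim S - dim M`, that is, of codimension at most that of
`S` in `M` (`exists_totallyGeodesic_inter`).

*Homogeneity.* Nearby points `p`, `q` are joined by a geodesic. The symmetry at its midpoint reverses
it, by uniqueness of geodesics, and so maps `p` to `q`. Hence the orbits of the isometry group are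
open, and `M` is connected. The exponential map and completeness are not needed: the geodesic from
`p` to `q` comes from a shooting argument for `u'' = X(u, u')` near an equilibrium
(`exists_solution_through`), in which the position at a fixed small time `τ` is, as a function of the
initial velocity, Lipschitz close to multiplication by `τ`.

*Intersections.* In charts, `N ∩ S` is the zero set of `Φ(x, y) = F x - H y`, where `F` and `H`
represent the two immersions, and the kernel of `dΦ` consists of the common tangent vectors. The
rank of `Φ` may vary, but each common tangent vector is the velocity of a geodesic of `M` that runs
in both submanifolds, and thus of a curve of zeros. Take a zero where the kernel has minimal
dimension `D`. Near it the zero set is contained in a `D`-dimensional submanifold, and every vector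
tangent to this submanifold at a zero is the velocity of a curve of zeros, so that the zeros fill it,
by a nearest point argument (`ball_subset_of_forall_tangent`, `exists_zeroSet_param`). This
replaces the usual description of the intersection by the exponential map.

*Totally geodesic in `N`.* A curve in `N` whose image in `M` is a geodesic is a geodesic of `N`. This
follows from the transformation law `christoffel_pullback` of the Christoffel symbols of the first
kind, which holds for maps between spaces of different dimensions (`IsGeodesicOn.of_comp`); the
same law, for the identity and for isometries, shows that the geodesic equation does not depend on the
chart and is preserved by isometries. -/

namespace RiemSym

open Set Filter Topology Metric

-- some instances on the fibres of a Riemannian bundle are not found at the default depth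
set_option maxSynthPendingDepth 3

/-! ### Zero sets all of whose formal tangent vectors are realized by curves -/

/-- A closed set to which every direction is tangent at each of its points (near `0`) contains a
neighbourhood of `0`. Otherwise a point outside has a nearest point `b` in the set, and moving
from `b` along a curve of the set in the direction of the outside point gets closer to it. -/
theorem ball_subset_of_forall_tangent {E : Type*} [NormedAddCommGroup E] [NormedSpace ℝ E]
    [ProperSpace E] {B : Set E} {R : ℝ} (hB : IsClosed B) (h0 : (0 : E) ∈ B)
    (h : ∀ b ∈ B, ‖b‖ < R → ∀ e : E, ∃ c : ℝ → E, c 0 = b ∧ HasDerivAt c e 0 ∧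
      ∀ᶠ t in 𝓝 (0 : ℝ), c t ∈ B) :
    ball (0 : E) (R / 2) ⊆ B := by
  intro x hx
  obtain ⟨b, hb, hbx⟩ := hB.exists_infDist_eq_dist ⟨0, h0⟩ x
  have hx' : ‖x‖ < R / 2 := by simpa using hx
  by_cases hxb : x = b
  · exact hxb ▸ hb
  have hmin : ∀ y ∈ B, ‖x - b‖ ≤ ‖x - y‖ := fun y hy => by
    rw [← dist_eq_norm, ← dist_eq_norm, ← hbx]; exact infDist_le_dist_of_mem hy
  have hbR : ‖b‖ < R := by
    have h1 := hmin 0 h0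
    have h2 : ‖b‖ ≤ ‖x‖ + ‖x - b‖ := by
      have := norm_sub_le x (x - b); simpa using this
    rw [sub_zero] at h1
    linarith
  obtain ⟨c, hc0, hc, hcB⟩ := h b hb hbR (x - b)
  have hpos : 0 < ‖x - b‖ := norm_pos_iff.2 (sub_ne_zero.2 hxb)
  have hsmall := (hasDerivAt_iff_isLittleO.1 hc).def (c := 1 / 2 * ‖x - b‖) (by positivity)
  have hlt : ∀ᶠ t in 𝓝[>] (0 : ℝ), t < 1 := nhdsWithin_le_nhds (Iio_mem_nhds one_pos)
  obtain ⟨t, ht, htB, ht1, ht0⟩ := ((hsmall.filter_mono nhdsWithin_le_nhds).and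
    ((hcB.filter_mono nhdsWithin_le_nhds).and (hlt.and self_mem_nhdsWithin))).exists
  have ht0 : 0 < t := ht0
  rw [hc0, sub_zero, Real.norm_of_nonneg ht0.le] at ht
  -- for small `t > 0` the point `c t ≈ b + t (x - b)` is nearer to `x` than `b` is
  have h1 := hmin _ htB
  have h2 : x - c t = (1 - t) • (x - b) - (c t - b - t • (x - b)) := by
    module
  have h3 : ‖x - c t‖ ≤ (1 - t) * ‖x - b‖ + 1 / 2 * ‖x - b‖ * t := by
    rw [h2]
    refine (norm_sub_le _ _).trans (add_le_add (le_of_eq ?_) ht)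
    rw [norm_smul, Real.norm_of_nonneg (by linarith)]
  nlinarith [mul_pos hpos ht0]

/-- Existence of a submanifold chart for a zero set `Φ⁻¹(0)` all of whose formal tangent vectors
(elements of `ker dΦ`) are velocities of curves in the zero set. The chart `ψ` is defined on a full
Euclidean space and `κ` is its inverse, extended to an open set `O` of the ambient space. The point
about which the chart is built is one where `ker dΦ` has minimal dimension. -/
theorem exists_zeroSet_param {P Q : Type*} [NormedAddCommGroup P] [NormedSpace ℝ P]
    [FiniteDimensional ℝ P] [NormedAddCommGroup Q] [NormedSpace ℝ Q] [FiniteDimensional ℝ Q]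
    {Ω : Set P} (hΩ : IsOpen Ω) {Φ : P → Q} (hΦ : ContDiffOn ℝ ∞ Φ Ω) {z₀ : P} (hz₀ : z₀ ∈ Ω)
    (hΦ₀ : Φ z₀ = 0)
    (htan : ∀ z ∈ Ω, Φ z = 0 → ∀ e, fderiv ℝ Φ z e = 0 → ∃ c : ℝ → P, c 0 = z ∧
      HasDerivAt c e 0 ∧ ∀ᶠ t in 𝓝 (0 : ℝ), Φ (c t) = 0) :
    ∃ D : ℕ, D ≤ Module.finrank ℝ (fderiv ℝ Φ z₀).ker ∧
      Module.finrank ℝ P ≤ D + Module.finrank ℝ Q ∧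
      ∃ (ψ : EuclideanSpace ℝ (Fin D) → P) (κ : P → EuclideanSpace ℝ (Fin D)) (O : Set P),
        ContDiff ℝ ∞ ψ ∧ IsOpen O ∧ DifferentiableOn ℝ κ O ∧
        (∀ u, ψ u ∈ O ∧ ψ u ∈ Ω ∧ Φ (ψ u) = 0 ∧ κ (ψ u) = u) ∧
        ∀ z ∈ O, Φ z = 0 → ψ (κ z) = z := by
  classical
  have : CompleteSpace P := FiniteDimensional.complete ℝ P
  have : CompleteSpace Q := FiniteDimensional.complete ℝ Q
  -- a point `z₁` of the zero set where the kernel has minimal dimension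
  obtain ⟨z₁, ⟨hz₁, hΦ₁⟩, hmin⟩ : ∃ z₁, (z₁ ∈ Ω ∧ Φ z₁ = 0) ∧ ∀ z, z ∈ Ω ∧ Φ z = 0 →
      Module.finrank ℝ (fderiv ℝ Φ z₁).ker ≤ Module.finrank ℝ (fderiv ℝ Φ z).ker := by
    let A : Set P := {z | z ∈ Ω ∧ Φ z = 0}
    let d : P → ℕ := fun z => Module.finrank ℝ (fderiv ℝ Φ z).ker
    have hne : (d '' A).Nonempty := ⟨_, z₀, ⟨hz₀, hΦ₀⟩, rfl⟩
    obtain ⟨z₁, h1, h2⟩ := Nat.sInf_mem hne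
    exact ⟨z₁, h1, fun z hz => h2.le.trans (Nat.sInf_le ⟨z, hz, rfl⟩)⟩
  set L := fderiv ℝ Φ z₁ with hL
  set D := Module.finrank ℝ L.ker with hD
  refine ⟨D, hmin z₀ ⟨hz₀, hΦ₀⟩, ?_, ?_⟩
  · have h1 := LinearMap.finrank_range_add_finrank_ker (L : P →ₗ[ℝ] Q)
    have h2 : Module.finrank ℝ (LinearMap.range (L : P →ₗ[ℝ] Q)) ≤ Module.finrank ℝ Q :=
      Submodule.finrank_le _
    change _ + D = _ at h1
    omega
  -- a projection `κ₀` onto the kernel, identified with `ℝ^D`, and one onto the range of `L`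
  have hfin : Module.finrank ℝ L.ker = Module.finrank ℝ (EuclideanSpace ℝ (Fin D)) := by simp [hD]
  let ι : L.ker ≃ₗ[ℝ] EuclideanSpace ℝ (Fin D) := LinearEquiv.ofFinrankEq _ _ hfin
  obtain ⟨p, hp⟩ := LinearMap.exists_leftInverse_of_injective L.ker.subtype
    (LinearMap.ker_eq_bot.2 (Submodule.injective_subtype _))
  have hp' : ∀ x : L.ker, p x = x := fun x => LinearMap.congr_fun hp x
  let κ₀ : P →L[ℝ] EuclideanSpace ℝ (Fin D) := LinearMap.toContinuousLinearMap (ι.toLinearMap ∘ₗ p)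
  have hκ₀ : ∀ x, κ₀ x = ι (p x) := fun x => rfl
  obtain ⟨q, hq⟩ := LinearMap.exists_leftInverse_of_injective
    (LinearMap.range (L : P →ₗ[ℝ] Q)).subtype
    (LinearMap.ker_eq_bot.2 (Submodule.injective_subtype _))
  have hq' : ∀ x : LinearMap.range (L : P →ₗ[ℝ] Q), q x = x := fun x => LinearMap.congr_fun hq x
  let pr : Q →L[ℝ] LinearMap.range (L : P →ₗ[ℝ] Q) := LinearMap.toContinuousLinearMap q
  have hpr : ∀ x, pr x = q x := fun x => rfl
  -- a local diffeomorphism at `z₁` which sends the zero set into `0 × ℝ^D`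
  let Θ : P → LinearMap.range (L : P →ₗ[ℝ] Q) × EuclideanSpace ℝ (Fin D) :=
    fun z => (pr (Φ z), κ₀ (z - z₁))
  have hΘ : ContDiffOn ℝ ∞ Θ Ω := by
    refine (pr.contDiff.comp_contDiffOn hΦ).prodMk (ContDiff.contDiffOn ?_)
    exact κ₀.contDiff.comp (contDiff_id.sub contDiff_const)
  have hΘ' : ∀ z ∈ Ω, HasFDerivAt Θ ((pr ∘L fderiv ℝ Φ z).prod κ₀) z := by
    intro z hz
    have h1 : DifferentiableAt ℝ Φ z :=
      (hΦ.contDiffAt (hΩ.mem_nhds hz)).differentiableAt (by simp)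
    refine (pr.hasFDerivAt.comp z h1.hasFDerivAt).prodMk ?_
    have := (κ₀.hasFDerivAt (x := z - z₁)).comp z ((hasFDerivAt_id z).sub_const z₁)
    exact this
  have hbij : Function.Bijective ((pr ∘L L).prod κ₀) := by
    have hinj : Function.Injective ((pr ∘L L).prod κ₀) := by
      rw [injective_iff_map_eq_zero]
      intro x hx
      have h1 : pr (L x) = 0 := congrArg Prod.fst hx
      have h2 : κ₀ x = 0 := congrArg Prod.snd hx
      have h3 : L x = 0 := by
        have := hq' ⟨L x, x, rfl⟩
        rw [hpr] at h1
        simpa [h1] using (congrArg Subtype.val this).symm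
      have h4 := hp' ⟨x, h3⟩
      rw [hκ₀, LinearEquiv.map_eq_zero_iff] at h2
      simpa [h2] using (congrArg Subtype.val h4).symm
    refine ⟨hinj, ?_⟩
    have hf : Module.finrank ℝ P =
        Module.finrank ℝ (LinearMap.range (L : P →ₗ[ℝ] Q) × EuclideanSpace ℝ (Fin D)) := by
      rw [Module.finrank_prod, ← LinearMap.finrank_range_add_finrank_ker (L : P →ₗ[ℝ] Q), ← hfin]
    exact (LinearMap.injective_iff_surjective_of_finrank_eq_finrank
      (f := ((pr ∘L L).prod κ₀).toLinearMap) hf).1 hinj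
  let Λ : P ≃L[ℝ] LinearMap.range (L : P →ₗ[ℝ] Q) × EuclideanSpace ℝ (Fin D) :=
    ContinuousLinearEquiv.ofBijective ((pr ∘L L).prod κ₀) (LinearMap.ker_eq_bot.2 hbij.1)
      (LinearMap.range_eq_top.2 hbij.2)
  have hΛ : HasFDerivAt Θ (Λ : P →L[ℝ] _) z₁ := by
    have := hΘ' z₁ hz₁
    convert this using 1
    ext x <;> rfl
  have hΘ₁ : ContDiffAt ℝ ∞ Θ z₁ := hΘ.contDiffAt (hΩ.mem_nhds hz₁)
  let e := hΘ₁.toOpenPartialHomeomorph Θ hΛ (by simp)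
  have he : ∀ z, e z = Θ z := fun z => rfl
  have hez₁ : z₁ ∈ e.source := hΘ₁.mem_toOpenPartialHomeomorph_source hΛ (by simp)
  have hΘz₁ : Θ z₁ = 0 := by simp [Θ, hΦ₁]
  -- the open set where the derivative of `Θ` is invertible
  let Ω' : Set P := {z | z ∈ Ω ∧ ∃ Λ' : P ≃L[ℝ] LinearMap.range (L : P →ₗ[ℝ] Q) ×
    EuclideanSpace ℝ (Fin D), (Λ' : P →L[ℝ] _) = (pr ∘L fderiv ℝ Φ z).prod κ₀}
  have hΩ' : Ω' ∈ 𝓝 z₁ := by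
    have hcont : ContinuousAt (fderiv ℝ Θ) z₁ :=
      (hΘ₁.fderiv_right (m := 0) (by simp)).continuousAt
    have h1 : range ((↑) : (P ≃L[ℝ] LinearMap.range (L : P →ₗ[ℝ] Q) ×
        EuclideanSpace ℝ (Fin D)) → P →L[ℝ] _) ∈ 𝓝 (fderiv ℝ Θ z₁) := by
      rw [hΛ.fderiv]; exact ContinuousLinearEquiv.nhds Λ
    filter_upwards [hcont h1, hΩ.mem_nhds hz₁] with z hz hzΩ
    obtain ⟨Λ', h⟩ := hz
    exact ⟨hzΩ, Λ', h.trans (hΘ' z hzΩ).fderiv⟩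
  -- a ball in `ℝ^D` whose image under `(0, u) ↦ Θ⁻¹ (0, u)` lies in `Ω'`
  have hsymm0 : e.symm (0, 0) = z₁ := by
    have := e.left_inv hez₁
    rwa [he, hΘz₁] at this
  let ψ₀ : EuclideanSpace ℝ (Fin D) → P := fun u => e.symm (0, u)
  have h0t : ((0, 0) : LinearMap.range (L : P →ₗ[ℝ] Q) × EuclideanSpace ℝ (Fin D)) ∈ e.target := by
    have := e.map_source hez₁
    rwa [he, hΘz₁] at this
  have hnear : ∀ᶠ u in 𝓝 (0 : EuclideanSpace ℝ (Fin D)), (0, u) ∈ e.target ∧ ψ₀ u ∈ Ω' := by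
    have hc : ContinuousAt (fun u : EuclideanSpace ℝ (Fin D) =>
      ((0, u) : LinearMap.range (L : P →ₗ[ℝ] Q) × EuclideanSpace ℝ (Fin D))) 0 := by fun_prop
    refine (hc.eventually (e.open_target.mem_nhds h0t)).and ?_
    refine (((e.continuousAt_symm h0t).comp_of_eq hc rfl).eventually ?_)
    simpa [hsymm0] using hΩ'
  obtain ⟨R, hR, hball⟩ := Metric.nhds_basis_closedBall.mem_iff.1 hnear
  have hball : ∀ u, ‖u‖ ≤ R → (0, u) ∈ e.target ∧ ψ₀ u ∈ Ω' := fun u hu => hball (by simpa using hu)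
  have hΘψ : ∀ u, ‖u‖ ≤ R → Θ (ψ₀ u) = (0, u) := fun u hu => e.right_inv (hball u hu).1
  have hsrc : ∀ u, ‖u‖ ≤ R → ψ₀ u ∈ e.source := fun u hu => e.map_target (hball u hu).1
  have hψcont : ContinuousOn ψ₀ (closedBall 0 R) := by
    intro u hu
    refine ((e.continuousAt_symm (hball u (by simpa using hu)).1).comp_of_eq
      (f := fun u => ((0 : LinearMap.range (L : P →ₗ[ℝ] Q)), u)) ?_ rfl).continuousWithinAt
    fun_prop
  -- points of the zero set near `ψ₀ u` are in the image of `ψ₀`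
  have hback : ∀ z ∈ e.source, Φ z = 0 → ψ₀ (κ₀ (z - z₁)) = z := by
    intro z hz hz0
    have := e.left_inv hz
    rw [he] at this
    simpa [Θ, hz0, ψ₀] using this
  -- the image of the ball is contained in the zero set
  let B : Set (EuclideanSpace ℝ (Fin D)) := {u | ‖u‖ ≤ R ∧ Φ (ψ₀ u) = 0}
  have hBclosed : IsClosed B := by
    have h1 : ContinuousOn (fun u => Φ (ψ₀ u)) (closedBall 0 R) :=
      hΦ.continuousOn.comp hψcont fun u hu => (hball u (by simpa using hu)).2.1
    have h2 := h1.preimage_isClosed_of_isClosed isClosed_closedBall (isClosed_singleton (x := 0))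
    convert h2 using 1
    ext u; simp [B]
  have h0B : (0 : EuclideanSpace ℝ (Fin D)) ∈ B := by
    refine ⟨by simp [hR.le], ?_⟩
    change Φ (e.symm (0, 0)) = 0
    rw [hsymm0, hΦ₁]
  have hsub : ball (0 : EuclideanSpace ℝ (Fin D)) (R / 2) ⊆ B := by
    refine ball_subset_of_forall_tangent hBclosed h0B fun u hu huR v => ?_
    obtain ⟨huΩ, Λ', hΛ'⟩ := (hball u hu.1).2
    -- the kernel of `dΦ` at `ψ₀ u` is mapped onto `ℝ^D`
    obtain ⟨ξ, hξ, hξv⟩ : ∃ ξ, fderiv ℝ Φ (ψ₀ u) ξ = 0 ∧ κ₀ ξ = v := by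
      set K := (fderiv ℝ Φ (ψ₀ u)).ker with hK
      have hKD : D ≤ Module.finrank ℝ K := hmin _ ⟨huΩ, hu.2⟩
      let r : K →ₗ[ℝ] EuclideanSpace ℝ (Fin D) := κ₀.toLinearMap ∘ₗ K.subtype
      have hr : Function.Injective r := by
        rw [injective_iff_map_eq_zero]
        intro x hx
        have hx1 : fderiv ℝ Φ (ψ₀ u) x = 0 := x.2
        have h1 : Λ' (x : P) = 0 := by
          have : Λ' (x : P) = (pr (fderiv ℝ Φ (ψ₀ u) x), κ₀ x) :=
            congrArg (fun l : P →L[ℝ] _ => l (x : P)) hΛ'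
          rw [this, hx1]
          exact Prod.ext (by simp) hx
        exact Subtype.ext ((map_eq_zero_iff Λ' Λ'.injective).1 h1)
      have hle := LinearMap.finrank_le_finrank_of_injective hr
      have hfe : Module.finrank ℝ K = Module.finrank ℝ (EuclideanSpace ℝ (Fin D)) := by
        rw [finrank_euclideanSpace_fin] at hle ⊢
        omega
      obtain ⟨x, hx⟩ := (LinearMap.injective_iff_surjective_of_finrank_eq_finrank hfe).1 hr v
      exact ⟨x, x.2, hx⟩
    obtain ⟨c, hc0, hc, hcΦ⟩ := htan _ huΩ hu.2 ξ hξ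
    have hder : HasDerivAt (fun t => κ₀ (c t - z₁)) v 0 := by
      have := κ₀.hasFDerivAt.comp_hasDerivAt (0 : ℝ) (hc.sub_const z₁)
      rwa [hξv] at this
    have h0 : κ₀ (c 0 - z₁) = u := by
      rw [hc0]; exact congrArg Prod.snd (hΘψ u hu.1)
    refine ⟨fun t => κ₀ (c t - z₁), h0, hder, ?_⟩
    have h1 : ∀ᶠ t in 𝓝 (0 : ℝ), c t ∈ e.source :=
      hc.continuousAt.eventually (by rw [hc0]; exact e.open_source.mem_nhds (hsrc u hu.1))
    have h2 : ∀ᶠ t in 𝓝 (0 : ℝ), ‖κ₀ (c t - z₁)‖ < R :=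
      hder.continuousAt.norm.eventually_lt continuousAt_const (by rwa [h0])
    filter_upwards [h1, h2, hcΦ] with t ht1 ht2 ht3
    exact ⟨ht2.le, by rw [hback _ ht1 ht3]; exact ht3⟩
  have hR2 : 0 < R / 2 := half_pos hR
  -- a diffeomorphism of `ℝ^D` onto the ball on which `ψ₀` takes values in the zero set
  let β := OpenPartialHomeomorph.univBall (0 : EuclideanSpace ℝ (Fin D)) (R / 2)
  have hβt : β.target = ball 0 (R / 2) := OpenPartialHomeomorph.univBall_target _ hR2
  have hβs : ∀ u, u ∈ β.source := fun u => by simp [β]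
  have hβ : ∀ u, ‖β u‖ < R / 2 := fun u => by
    have := β.map_source (hβs u)
    rw [hβt] at this
    simpa using this
  have hβR : ∀ u, ‖β u‖ ≤ R := fun u => by linarith [hβ u]
  let O : Set P := e.source ∩ {z | κ₀ (z - z₁) ∈ ball (0 : EuclideanSpace ℝ (Fin D)) (R / 2)}
  have hκψ : ∀ u, ‖u‖ ≤ R → κ₀ (ψ₀ u - z₁) = u := fun u hu => congrArg Prod.snd (hΘψ u hu)
  refine ⟨fun u => ψ₀ (β u), fun z => β.symm (κ₀ (z - z₁)), O, ?_, ?_, ?_, ?_, ?_⟩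
  · rw [contDiff_iff_contDiffAt]
    intro u
    obtain ⟨huΩ, Λ', hΛ'⟩ := (hball _ (hβR u)).2
    have h1 : ContDiffAt ℝ ∞ e.symm (0, β u) := by
      refine e.contDiffAt_symm (f₀' := Λ') (hball _ (hβR u)).1 ?_
        (hΘ.contDiffAt (hΩ.mem_nhds huΩ))
      rw [hΛ']; exact hΘ' _ huΩ
    have h2 : ContDiffAt ℝ ∞ (fun u => ((0 : LinearMap.range (L : P →ₗ[ℝ] Q)), β u)) u :=
      contDiffAt_const.prodMk OpenPartialHomeomorph.contDiff_univBall.contDiffAt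
    exact h1.comp u h2
  · refine e.open_source.inter (isOpen_ball.preimage ?_)
    fun_prop
  · have h1 : DifferentiableOn ℝ β.symm (ball 0 (R / 2)) :=
      (OpenPartialHomeomorph.contDiffOn_univBall_symm (n := 1)).differentiableOn (by simp)
    refine h1.comp (Differentiable.differentiableOn ?_) fun z hz => hz.2
    fun_prop
  · intro u
    refine ⟨⟨hsrc _ (hβR u), ?_⟩, (hball _ (hβR u)).2.1, (hsub (by simpa using hβ u)).2, ?_⟩
    · change κ₀ (ψ₀ (β u) - z₁) ∈ ball (0 : EuclideanSpace ℝ (Fin D)) (R / 2)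
      rw [hκψ _ (hβR u)]
      simpa using hβ u
    · change β.symm (κ₀ (ψ₀ (β u) - z₁)) = u
      rw [hκψ _ (hβR u), β.left_inv (hβs u)]
  · intro z hz hz0
    change ψ₀ (β (β.symm (κ₀ (z - z₁)))) = z
    rw [β.right_inv (by rw [hβt]; exact hz.2)]
    exact hback z hz.1 hz0

/-! ### Christoffel symbols and the geodesic equation under pullback -/

section Coordinates

variable {E₁ E₂ : Type*} [NormedAddCommGroup E₁] [NormedSpace ℝ E₁]
  [NormedAddCommGroup E₂] [NormedSpace ℝ E₂]

/-- The Christoffel symbols of the first kind of a family `g` of bilinear forms on a vector space,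
contracted with the vectors `u`, `v`, `w`. -/
noncomputable def christoffel (g : E₁ → E₁ → E₁ → ℝ) (y u v w : E₁) : ℝ :=
  (fderiv ℝ (fun z => g z v w) y u + fderiv ℝ (fun z => g z u w) y v
    - fderiv ℝ (fun z => g z u v) y w) / 2

theorem fderiv_bilin_apply {B : E₁ → E₁ →L[ℝ] E₁ →L[ℝ] ℝ} {y : E₁} (hB : DifferentiableAt ℝ B y)
    (v w u : E₁) : fderiv ℝ (fun z => B z v w) y u = fderiv ℝ B y u v w := by
  have h := (hB.hasFDerivAt.clm_apply (hasFDerivAt_const v y)).clm_apply (hasFDerivAt_const w y)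
  rw [h.fderiv]
  simp

theorem christoffel_bilin {B : E₁ → E₁ →L[ℝ] E₁ →L[ℝ] ℝ} {y : E₁} (hB : DifferentiableAt ℝ B y)
    (u v w : E₁) : christoffel (fun z v w => B z v w) y u v w =
      (fderiv ℝ B y u v w + fderiv ℝ B y v u w - fderiv ℝ B y w u v) / 2 := by
  simp only [christoffel, fderiv_bilin_apply hB]

/-- The transformation law of the Christoffel symbols of the first kind under pullback of a metric
by a map `φ` (between spaces of possibly different dimensions). -/
theorem christoffel_pullback {g : E₁ → E₁ → E₁ → ℝ} {B : E₂ → E₂ →L[ℝ] E₂ →L[ℝ] ℝ}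
    {φ : E₁ → E₂} {y : E₁} (hB : DifferentiableAt ℝ B (φ y))
    (hsymm : ∀ v w, B (φ y) v w = B (φ y) w v) (hφ : ContDiffAt ℝ 2 φ y)
    (h : ∀ᶠ z in 𝓝 y, ∀ v w, g z v w = B (φ z) (fderiv ℝ φ z v) (fderiv ℝ φ z w)) (u v w : E₁) :
    christoffel g y u v w =
      christoffel (fun z v w => B z v w) (φ y) (fderiv ℝ φ y u) (fderiv ℝ φ y v) (fderiv ℝ φ y w)
        + B (φ y) (fderiv ℝ (fderiv ℝ φ) y u v) (fderiv ℝ φ y w) := by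
  have hφ1 : DifferentiableAt ℝ φ y := hφ.differentiableAt (by simp)
  have hφ2 : DifferentiableAt ℝ (fderiv ℝ φ) y :=
    (hφ.fderiv_right (m := 1) (by norm_num)).differentiableAt (by simp)
  have hs : ∀ a b, fderiv ℝ (fderiv ℝ φ) y a b = fderiv ℝ (fderiv ℝ φ) y b a := fun a b =>
    (hφ.isSymmSndFDerivAt (by simp)) a b
  have key : ∀ u v w, fderiv ℝ (fun z => g z v w) y u =
      fderiv ℝ B (φ y) (fderiv ℝ φ y u) (fderiv ℝ φ y v) (fderiv ℝ φ y w)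
      + B (φ y) (fderiv ℝ (fderiv ℝ φ) y u v) (fderiv ℝ φ y w)
      + B (φ y) (fderiv ℝ φ y v) (fderiv ℝ (fderiv ℝ φ) y u w) := by
    intro u v w
    have h1 : ∀ v, HasFDerivAt (fun z => fderiv ℝ φ z v) _ y := fun v =>
      hφ2.hasFDerivAt.clm_apply (hasFDerivAt_const v y)
    have h2 := ((hB.hasFDerivAt.comp y hφ1.hasFDerivAt).clm_apply (h1 v)).clm_apply (h1 w)
    have h3 : fderiv ℝ (fun z => g z v w) y = _ :=
      (Filter.EventuallyEq.fderiv_eq (h.mono fun z hz => hz v w)).trans h2.fderiv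
    rw [h3]
    simp
    ring
  rw [christoffel_bilin hB]
  simp only [christoffel, key]
  rw [hs v u, hs w u, hs w v, hsymm (fderiv ℝ (fderiv ℝ φ) y u w) (fderiv ℝ φ y v)]
  ring

theorem deriv_comp_eventuallyEq {φ : E₁ → E₂} {c : ℝ → E₁} {t : ℝ}
    (hφ : ContDiffAt ℝ 2 φ (c t)) (hc : ContDiffAt ℝ 2 c t) :
    deriv (φ ∘ c) =ᶠ[𝓝 t] fun s => fderiv ℝ φ (c s) (deriv c s) := by
  have h1 : ∀ᶠ z in 𝓝 (c t), DifferentiableAt ℝ φ z :=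
    (hφ.eventually (by simp)).mono fun z hz => hz.differentiableAt (by simp)
  have h2 : ∀ᶠ s in 𝓝 t, DifferentiableAt ℝ c s :=
    (hc.eventually (by simp)).mono fun z hz => hz.differentiableAt (by simp)
  filter_upwards [hc.continuousAt.eventually h1, h2] with s hs1 hs2
  exact (hs1.hasFDerivAt.comp_hasDerivAt s hs2.hasDerivAt).deriv

theorem deriv_deriv_comp {φ : E₁ → E₂} {c : ℝ → E₁} {t : ℝ}
    (hφ : ContDiffAt ℝ 2 φ (c t)) (hc : ContDiffAt ℝ 2 c t) :
    deriv (deriv (φ ∘ c)) t = fderiv ℝ (fderiv ℝ φ) (c t) (deriv c t) (deriv c t)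
      + fderiv ℝ φ (c t) (deriv (deriv c) t) := by
  have hφ2 : DifferentiableAt ℝ (fderiv ℝ φ) (c t) :=
    (hφ.fderiv_right (m := 1) (by norm_num)).differentiableAt (by simp)
  have hc1 : DifferentiableAt ℝ c t := hc.differentiableAt (by simp)
  have hc2 : DifferentiableAt ℝ (deriv c) t := by
    have h := (hc.fderiv_right (m := 1) (by norm_num)).differentiableAt (by simp)
    exact h.clm_apply (differentiableAt_const 1)
  rw [(deriv_comp_eventuallyEq hφ hc).deriv_eq]
  exact ((hφ2.hasFDerivAt.comp_hasDerivAt t hc1.hasDerivAt).clm_apply hc2.hasDerivAt).deriv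

/-- The left hand side of the geodesic equation (with lowered index) of `g` for the curve `u`. -/
noncomputable def geodesicExpr (g : E₁ → E₁ → E₁ → ℝ) (u : ℝ → E₁) (t : ℝ) (w : E₁) : ℝ :=
  g (u t) (deriv (deriv u) t) w + christoffel g (u t) (deriv u t) (deriv u t) w

/-- The geodesic expressions of a pullback metric and of the metric itself agree on tangential
vectors: the second derivatives of `φ` in `christoffel_pullback` cancel those in the acceleration. -/
theorem geodesicExpr_pullback {g : E₁ → E₁ → E₁ → ℝ} {B : E₂ → E₂ →L[ℝ] E₂ →L[ℝ] ℝ}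
    {φ : E₁ → E₂} {c : ℝ → E₁} {t : ℝ} (hB : DifferentiableAt ℝ B (φ (c t)))
    (hsymm : ∀ v w, B (φ (c t)) v w = B (φ (c t)) w v) (hφ : ContDiffAt ℝ 2 φ (c t))
    (hc : ContDiffAt ℝ 2 c t)
    (h : ∀ᶠ z in 𝓝 (c t), ∀ v w, g z v w = B (φ z) (fderiv ℝ φ z v) (fderiv ℝ φ z w)) (w : E₁) :
    geodesicExpr g c t w =
      geodesicExpr (fun z v w => B z v w) (φ ∘ c) t (fderiv ℝ φ (c t) w) := by
  have h1 := (deriv_comp_eventuallyEq hφ hc).self_of_nhds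
  simp only [geodesicExpr, christoffel_pullback hB hsymm hφ h, deriv_deriv_comp hφ hc, h1,
    h.self_of_nhds, map_add, add_apply, Function.comp_apply]
  ring

/-- The geodesic equation of a Riemannian metric in coordinates, solved for the acceleration: it
reads `u'' = X(u, u')`, and the constant curves solve it. -/
theorem exists_geodesicSpray [FiniteDimensional ℝ E₁] {B : E₁ → E₁ →L[ℝ] E₁ →L[ℝ] ℝ} {U : Set E₁}
    (hU : IsOpen U) (hB : ContDiffOn ℝ ∞ B U) (hpos : ∀ y ∈ U, ∀ v, v ≠ 0 → 0 < B y v v) :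
    ∃ X : E₁ × E₁ → E₁, ContDiffOn ℝ ∞ X (U ×ˢ univ) ∧ ∀ y ∈ U, X (y, 0) = 0 ∧ ∀ a b,
      (∀ w, B y a w + christoffel (fun z v w => B z v w) y b b w = 0) ↔ a = X (y, b) := by
  have : CompleteSpace E₁ := FiniteDimensional.complete ℝ E₁
  have hinv : ∀ y ∈ U, ∃ Λ : E₁ ≃L[ℝ] (E₁ →L[ℝ] ℝ), (Λ : E₁ →L[ℝ] (E₁ →L[ℝ] ℝ)) = B y := by
    intro y hy
    have hinj : Function.Injective (B y) := by
      rw [injective_iff_map_eq_zero]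
      intro v hv
      by_contra hne
      have := hpos y hy v hne
      simp [hv] at this
    have hfe : Module.finrank ℝ E₁ = Module.finrank ℝ (E₁ →L[ℝ] ℝ) := by
      rw [← (LinearMap.toContinuousLinearMap : (E₁ →ₗ[ℝ] ℝ) ≃ₗ[ℝ] _).finrank_eq]
      exact (Subspace.dual_finrank_eq).symm
    have hsurj := (LinearMap.injective_iff_surjective_of_finrank_eq_finrank
      (f := (B y).toLinearMap) hfe).1 hinj
    refine ⟨ContinuousLinearEquiv.ofBijective (B y) (LinearMap.ker_eq_bot.2 hinj)
      (LinearMap.range_eq_top.2 hsurj), ?_⟩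
    ext; rfl
  let C : E₁ × E₁ → E₁ →L[ℝ] ℝ := fun z => fderiv ℝ B z.1 z.2 z.2
    - (1 / 2 : ℝ) • ((fderiv ℝ B z.1).flip z.2).flip z.2
  have hdB : ContDiffOn ℝ ∞ (fun z : E₁ × E₁ => fderiv ℝ B z.1) (U ×ˢ univ) :=
    (hB.fderiv_of_isOpen hU (m := ∞) (by simp)).comp contDiffOn_fst fun z hz => hz.1
  have hCval : ∀ y ∈ U, ∀ b w, C (y, b) w = christoffel (fun z v w => B z v w) y b b w := by
    intro y hy b w
    rw [christoffel_bilin ((hB.contDiffAt (hU.mem_nhds hy)).differentiableAt (by simp))]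
    simp [C]
    ring
  have hC : ContDiffOn ℝ ∞ C (U ×ˢ univ) := by
    rw [contDiffOn_clm_apply]
    intro w
    have h1 : ∀ (f g h : E₁ × E₁ → E₁), ContDiff ℝ ∞ f → ContDiff ℝ ∞ g → ContDiff ℝ ∞ h →
        ContDiffOn ℝ ∞ (fun z : E₁ × E₁ => fderiv ℝ B z.1 (f z) (g z) (h z)) (U ×ˢ univ) :=
      fun f g h hf hg hh => ((hdB.clm_apply hf.contDiffOn).clm_apply hg.contDiffOn).clm_apply
        hh.contDiffOn
    have h2 := (h1 _ _ _ contDiff_snd contDiff_snd (contDiff_const (c := w))).sub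
      (contDiffOn_const (c := (1 / 2 : ℝ)) |>.mul
        (h1 _ _ _ (contDiff_const (c := w)) contDiff_snd contDiff_snd))
    refine h2.congr fun z _ => ?_
    simp [C]
  refine ⟨fun z => -(ContinuousLinearMap.inverse (B z.1) (C z)), ?_, ?_⟩
  · refine ContDiffOn.neg (ContDiffOn.clm_apply ?_ hC)
    intro z hz
    obtain ⟨Λ, hΛ⟩ := hinv z.1 hz.1
    have h1 : ContDiffAt ℝ ∞ ContinuousLinearMap.inverse (B z.1) := by
      rw [← hΛ]; exact contDiffAt_map_inverse Λ
    have h2 : ContDiffAt ℝ ∞ (fun z : E₁ × E₁ => B z.1) z :=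
      (hB.contDiffAt (hU.mem_nhds hz.1)).comp z contDiffAt_fst
    exact (h1.comp z h2).contDiffWithinAt
  · intro y hy
    obtain ⟨Λ, hΛ⟩ := hinv y hy
    refine ⟨by simp [C], fun a b => ?_⟩
    have h1 : (∀ w, B y a w + christoffel (fun z v w => B z v w) y b b w = 0) ↔
        Λ a + C (y, b) = 0 := by
      rw [ContinuousLinearMap.ext_iff]
      refine forall_congr' fun w => ?_
      rw [← hCval y hy, ← hΛ]
      rfl
    rw [h1]
    simp only [← hΛ, ContinuousLinearMap.inverse_equiv]
    rw [← map_neg]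
    constructor
    · intro h
      rw [← eq_neg_iff_add_eq_zero] at h
      rw [← h]; simp
    · rintro rfl; simp

end Coordinates

/-! ### Second order differential equations -/

section SecondOrderODE

variable {E : Type*} [NormedAddCommGroup E] [NormedSpace ℝ E]

/-- Local uniqueness for a second order equation `u'' = X(u, u')`. -/
theorem eventuallyEq_of_deriv_deriv_eq {X : E × E → E} {u₁ u₂ : ℝ → E} {t : ℝ}
    (hX : ContDiffAt ℝ 1 X (u₁ t, deriv u₁ t)) (hu₁ : ContDiffAt ℝ 2 u₁ t)
    (hu₂ : ContDiffAt ℝ 2 u₂ t)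
    (h₁ : ∀ᶠ s in 𝓝 t, deriv (deriv u₁) s = X (u₁ s, deriv u₁ s))
    (h₂ : ∀ᶠ s in 𝓝 t, deriv (deriv u₂) s = X (u₂ s, deriv u₂ s))
    (h0 : u₁ t = u₂ t) (h1 : deriv u₁ t = deriv u₂ t) : u₁ =ᶠ[𝓝 t] u₂ := by
  have hF : ContDiffAt ℝ 1 (fun z : E × E => (z.2, X z)) (u₁ t, deriv u₁ t) :=
    contDiffAt_snd.prodMk hX
  obtain ⟨K, V, hV, hK⟩ := hF.exists_lipschitzOnWith
  have key : ∀ u : ℝ → E, ContDiffAt ℝ 2 u t → u t = u₁ t → deriv u t = deriv u₁ t →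
      (∀ᶠ s in 𝓝 t, deriv (deriv u) s = X (u s, deriv u s)) →
      ∀ᶠ s in 𝓝 t, HasDerivAt (fun s => (u s, deriv u s)) (deriv u s, X (u s, deriv u s)) s ∧
        (u s, deriv u s) ∈ V := by
    intro u hu hu0 hu1 hs
    have hd : ∀ s, ContDiffAt ℝ 2 u s → DifferentiableAt ℝ (deriv u) s := fun s hs =>
      ((hs.fderiv_right (m := 1) (by norm_num)).differentiableAt (by simp)).clm_apply
        (differentiableAt_const 1)
    have hV' : ∀ᶠ s in 𝓝 t, (u s, deriv u s) ∈ V := by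
      have hc : ContinuousAt (fun s => (u s, deriv u s)) t :=
        hu.continuousAt.prodMk (hd t hu).continuousAt
      exact hc.eventually (p := (· ∈ V)) (by rw [← hu0, ← hu1] at hV; exact hV)
    filter_upwards [hs, hV', hu.eventually (by simp)] with s hs1 hs2 hs3
    refine ⟨?_, hs2⟩
    rw [← hs1]
    exact (hs3.differentiableAt (by simp)).hasDerivAt.prodMk (hd s hs3).hasDerivAt
  have := ODE_solution_unique_of_eventually (v := fun _ z => (z.2, X z)) (s := fun _ => V)
    (Eventually.of_forall fun _ => hK) (key u₁ hu₁ rfl rfl h₁) (key u₂ hu₂ h0.symm h1.symm h₂)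
    (Prod.ext h0 h1)
  exact this.mono fun s hs => congrArg Prod.fst hs

/-- Two solutions of `u'' = X(u, u')` with the same initial value separate almost linearly, for a
short time, in their initial velocities. -/
theorem norm_sub_sub_smul_le {X : E × E → E} {V : Set (E × E)} {K : NNReal}
    (hX : LipschitzOnWith K X V) {τ : ℝ} (hτ : 0 ≤ τ) (hτ1 : τ ≤ 1) (hKτ : K * τ ≤ 1 / 4)
    {x₁ y₁ x₂ y₂ : ℝ → E}
    (h₁ : ∀ s ∈ Icc 0 τ, (x₁ s, y₁ s) ∈ V ∧ HasDerivAt x₁ (y₁ s) s ∧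
      HasDerivAt y₁ (X (x₁ s, y₁ s)) s)
    (h₂ : ∀ s ∈ Icc 0 τ, (x₂ s, y₂ s) ∈ V ∧ HasDerivAt x₂ (y₂ s) s ∧
      HasDerivAt y₂ (X (x₂ s, y₂ s)) s) (h0 : x₁ 0 = x₂ 0) :
    ‖x₁ τ - x₂ τ - τ • (y₁ 0 - y₂ 0)‖ ≤ τ / 3 * ‖y₁ 0 - y₂ 0‖ := by
  have h0τ : (0 : ℝ) ∈ Icc 0 τ := ⟨le_rfl, hτ⟩
  have hττ : τ ∈ Icc 0 τ := ⟨hτ, le_rfl⟩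
  have hD : ContinuousOn (fun s => ‖y₁ s - y₂ s‖) (Icc 0 τ) := fun s hs =>
    ((h₁ s hs).2.2.continuousAt.sub (h₂ s hs).2.2.continuousAt).norm.continuousWithinAt
  obtain ⟨s₀, hs₀, hmax⟩ := isCompact_Icc.exists_isMaxOn ⟨0, h0τ⟩ hD
  -- `m` bounds the difference of the velocities; it is estimated by the initial one below
  set m := ‖y₁ s₀ - y₂ s₀‖ with hm
  have hmax : ∀ s ∈ Icc 0 τ, ‖y₁ s - y₂ s‖ ≤ m := fun s hs => hmax hs
  have hm0 : 0 ≤ m := norm_nonneg _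
  have hx : ∀ s ∈ Icc 0 τ, ‖x₁ s - x₂ s‖ ≤ m := by
    intro s hs
    have := norm_image_sub_le_of_norm_deriv_le_segment' (f := fun s => x₁ s - x₂ s)
      (f' := fun s => y₁ s - y₂ s) (C := m)
      (fun s hs => ((h₁ s hs).2.1.sub (h₂ s hs).2.1).hasDerivWithinAt)
      (fun s hs => hmax s (Ico_subset_Icc_self hs)) s hs
    rw [h0, sub_self, sub_zero, sub_zero] at this
    nlinarith [hs.1, hs.2]
  have hy : ∀ s ∈ Icc 0 τ, ‖y₁ s - y₂ s - (y₁ 0 - y₂ 0)‖ ≤ K * τ * m := by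
    intro s hs
    have := norm_image_sub_le_of_norm_deriv_le_segment' (f := fun s => y₁ s - y₂ s)
      (f' := fun s => X (x₁ s, y₁ s) - X (x₂ s, y₂ s)) (C := K * m)
      (fun s hs => ((h₁ s hs).2.2.sub (h₂ s hs).2.2).hasDerivWithinAt)
      (fun s hs => by
        have hs' := Ico_subset_Icc_self hs
        refine (hX.norm_sub_le (h₁ s hs').1 (h₂ s hs').1).trans ?_
        gcongr
        exact max_le (hx s hs') (hmax s hs')) s hs
    refine this.trans ?_
    have : (K : ℝ) * m * (s - 0) ≤ K * m * τ := by
      gcongr; linarith [hs.2]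
    linarith
  have hmle : m ≤ 4 / 3 * ‖y₁ 0 - y₂ 0‖ := by
    have h1 := hy s₀ hs₀
    have h2 : m ≤ ‖y₁ s₀ - y₂ s₀ - (y₁ 0 - y₂ 0)‖ + ‖y₁ 0 - y₂ 0‖ := by
      have := norm_add_le (y₁ s₀ - y₂ s₀ - (y₁ 0 - y₂ 0)) (y₁ 0 - y₂ 0)
      rwa [sub_add_cancel] at this
    nlinarith
  have hfin := norm_image_sub_le_of_norm_deriv_le_segment'
    (f := fun s => x₁ s - x₂ s - s • (y₁ 0 - y₂ 0))
    (f' := fun s => y₁ s - y₂ s - (y₁ 0 - y₂ 0)) (C := ‖y₁ 0 - y₂ 0‖ / 3)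
    (fun s hs => by
      have h1 := ((h₁ s hs).2.1.sub (h₂ s hs).2.1).sub ((hasDerivAt_id s).smul_const (y₁ 0 - y₂ 0))
      rw [one_smul] at h1
      exact h1.hasDerivWithinAt)
    (fun s hs => (hy s (Ico_subset_Icc_self hs)).trans (by nlinarith)) τ hττ
  simp only [h0, sub_self, zero_smul, sub_zero] at hfin
  linarith

/-- Every point near an equilibrium `x₀` of `u'' = X(u, u')` is reached from `x₀` by a solution, in
a fixed time `τ`, that stays in a prescribed neighbourhood. -/
theorem exists_solution_through [CompleteSpace E] {X : E × E → E} {x₀ : E}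
    (hX : ContDiffAt ℝ 1 X (x₀, 0)) (hX0 : X (x₀, 0) = 0) {V : Set (E × E)} (hV : V ∈ 𝓝 (x₀, 0)) :
    ∃ τ ε : ℝ, 0 < τ ∧ τ < ε ∧ ∀ᶠ q in 𝓝 x₀, ∃ x y : ℝ → E, x 0 = x₀ ∧ x τ = q ∧
      ∀ s ∈ Ioo (-ε) ε, (x s, y s) ∈ V ∧ HasDerivAt x (y s) s ∧ HasDerivAt y (X (x s, y s)) s := by
  obtain ⟨K, V', hV', hK⟩ := hX.exists_lipschitzOnWith
  have hF : ContDiffAt ℝ 1 (fun z : E × E => (z.2, X z)) (x₀, 0) := contDiffAt_snd.prodMk hX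
  obtain ⟨ε₀, hε₀, a, r, L, K', hr, hPL⟩ := IsPicardLindelof.of_contDiffAt_one hF
  obtain ⟨α, hα, hαc⟩ := (hPL 0).exists_forall_mem_closedBall_eq_hasDerivWithinAt_continuousOn
  simp only [zero_sub, zero_add] at hα hαc
  -- the solutions stay in `V ∩ V'` for small initial velocities and times
  have h0 : α ((x₀, 0), 0) = (x₀, 0) := (hα _ (mem_closedBall_self r.2)).1
  have hin : ∀ᶠ p in 𝓝 (((x₀, 0) : E × E), (0 : ℝ)), α p ∈ V ∩ V' := by
    have hn : closedBall ((x₀, 0) : E × E) r ×ˢ Icc (-ε₀) ε₀ ∈ 𝓝 (((x₀, 0) : E × E), (0 : ℝ)) :=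
      prod_mem_nhds (closedBall_mem_nhds _ hr) (Icc_mem_nhds (by linarith) hε₀)
    refine (hαc.continuousAt hn).eventually ?_
    rw [h0]; exact inter_mem hV hV'
  rw [nhds_prod_eq, eventually_prod_iff] at hin
  obtain ⟨p, hp, q, hq, hpq⟩ := hin
  have hp' : ∀ᶠ v in 𝓝 (0 : E), p (x₀, v) ∧ (x₀, v) ∈ closedBall ((x₀, 0) : E × E) r := by
    have hc : ContinuousAt (fun v : E => (x₀, v)) 0 := by fun_prop
    exact (hc.eventually hp).and (hc.eventually (closedBall_mem_nhds _ hr))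
  obtain ⟨ρ, hρ, hρball⟩ := Metric.nhds_basis_ball.mem_iff.1 hp'
  obtain ⟨ε₁, hε₁, hε₁ball⟩ := Metric.nhds_basis_ball.mem_iff.1 hq
  set ε := min ε₀ ε₁ with hε
  have hεpos : 0 < ε := lt_min hε₀ hε₁
  set τ := min (ε / 2) (min 1 (1 / (4 * (K + 1)))) with hτ
  have hτpos : 0 < τ := by positivity
  have hτε : τ < ε := (min_le_left _ _).trans_lt (by linarith)
  have hτ1 : τ ≤ 1 := (min_le_right _ _).trans (min_le_left _ _)
  have hKτ : K * τ ≤ 1 / 4 := by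
    have h1 : τ ≤ 1 / (4 * (K + 1)) := (min_le_right _ _).trans (min_le_right _ _)
    calc (K : ℝ) * τ ≤ (K + 1) * (1 / (4 * (K + 1))) := by gcongr; linarith
      _ = 1 / 4 := by field_simp
  have hsol : ∀ v ∈ ball (0 : E) ρ, ∀ s ∈ Ioo (-ε) ε, α ((x₀, v), s) ∈ V ∩ V' ∧
      HasDerivAt (fun s => (α ((x₀, v), s)).1) (α ((x₀, v), s)).2 s ∧
      HasDerivAt (fun s => (α ((x₀, v), s)).2) (X (α ((x₀, v), s))) s := by
    intro v hv s hs
    have hs0 : s ∈ Ioo (-ε₀) ε₀ :=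
      ⟨by linarith [hs.1, min_le_left ε₀ ε₁], hs.2.trans_le (min_le_left _ _)⟩
    have hs1 : s ∈ ball (0 : ℝ) ε₁ := by
      rw [Real.ball_eq_Ioo]
      exact ⟨by linarith [hs.1, min_le_right ε₀ ε₁], by linarith [hs.2, min_le_right ε₀ ε₁]⟩
    have hd := ((hα _ (hρball hv).2).2 s (Ioo_subset_Icc_self hs0)).hasDerivAt
      (Icc_mem_nhds hs0.1 hs0.2)
    exact ⟨hpq (hρball hv).1 (hε₁ball hs1), hd.fst, hd.snd⟩
  have hinit : ∀ v ∈ ball (0 : E) ρ, α ((x₀, v), 0) = (x₀, v) := fun v hv =>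
    (hα _ (hρball hv).2).1
  have hIcc : Icc 0 τ ⊆ Ioo (-ε) ε := fun s hs => ⟨by linarith [hs.1], by linarith [hs.2]⟩
  let f : E → E := fun v => (α ((x₀, v), τ)).1
  -- the position at time `τ` is close enough to `v ↦ x₀ + τ v` to be an open map near `0`
  have hf : ApproximatesLinearOn f (τ • ContinuousLinearMap.id ℝ E) (ball 0 ρ)
      ⟨τ / 3, by positivity⟩ := by
    intro v hv w hw
    have := norm_sub_sub_smul_le hK hτpos.le hτ1 hKτ
      (fun s hs => ⟨(hsol v hv s (hIcc hs)).1.2, (hsol v hv s (hIcc hs)).2⟩)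
      (fun s hs => ⟨(hsol w hw s (hIcc hs)).1.2, (hsol w hw s (hIcc hs)).2⟩)
      (by rw [hinit v hv, hinit w hw])
    rwa [hinit v hv, hinit w hw] at this
  let inv : (τ • ContinuousLinearMap.id ℝ E).NonlinearRightInverse :=
    { toFun := fun y => τ⁻¹ • y
      nnnorm := ⟨τ⁻¹, by positivity⟩
      bound' := fun y => by
        rw [norm_smul, Real.norm_of_nonneg (by positivity)]; rfl
      right_inv' := fun y => by simp [smul_smul, hτpos.ne'] }
  have hf0 : f 0 = x₀ := by
    -- the constant curve is a solution as well
    have h0ρ : (0 : E) ∈ ball (0 : E) ρ := mem_ball_self hρ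
    have := norm_sub_sub_smul_le hK hτpos.le hτ1 hKτ (x₂ := fun _ => x₀) (y₂ := fun _ => 0)
      (fun s hs => ⟨(hsol 0 h0ρ s (hIcc hs)).1.2, (hsol 0 h0ρ s (hIcc hs)).2⟩)
      (fun s hs => ⟨mem_of_mem_nhds hV', hasDerivAt_const s x₀, by
        rw [hX0]; exact hasDerivAt_const s 0⟩) (by rw [hinit 0 h0ρ])
    rw [hinit 0 h0ρ] at this
    simpa [sub_eq_zero] using this
  refine ⟨τ, ε, hτpos, hτε, ?_⟩
  have himg : f '' ball 0 ρ ∈ 𝓝 (f 0) := by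
    refine hf.image_mem_nhds inv (ball_mem_nhds _ hρ) (Or.inr ?_)
    change τ / 3 < (τ⁻¹)⁻¹
    rw [inv_inv]; linarith
  rw [hf0] at himg
  filter_upwards [himg] with q hq
  obtain ⟨v, hv, rfl⟩ := hq
  refine ⟨fun s => (α ((x₀, v), s)).1, fun s => (α ((x₀, v), s)).2, ?_, rfl, fun s hs => ?_⟩
  · exact congrArg Prod.fst (hinit v hv)
  · exact ⟨(hsol v hv s hs).1.1, (hsol v hv s hs).2⟩

end SecondOrderODE

/-! ### Charts, local representatives, and the metric in coordinates -/

section Charts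

variable {n : ℕ} {M : Type*} [TopologicalSpace M] [ChartedSpace (EuclideanSpace ℝ (Fin n)) M]

/-- The differential of the inverse chart at `x₀`, sending coordinates to tangent vectors. -/
noncomputable def coordVec (x₀ : M) (y : EuclideanSpace ℝ (Fin n)) :
    EuclideanSpace ℝ (Fin n) →L[ℝ] TangentSpace (𝓡 n) ((extChartAt (𝓡 n) x₀).symm y) :=
  mfderiv 𝓘(ℝ, EuclideanSpace ℝ (Fin n)) (𝓡 n) (extChartAt (𝓡 n) x₀).symm y

variable [IsManifold (𝓡 n) ∞ M]

theorem contMDiffAt_extChartAt_symm {x₀ : M} {y : EuclideanSpace ℝ (Fin n)}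
    (hy : y ∈ (extChartAt (𝓡 n) x₀).target) :
    ContMDiffAt 𝓘(ℝ, EuclideanSpace ℝ (Fin n)) (𝓡 n) ∞ (extChartAt (𝓡 n) x₀).symm y :=
  (contMDiffOn_extChartAt_symm x₀).contMDiffAt ((isOpen_extChartAt_target x₀).mem_nhds hy)

theorem contMDiffAt_extChartAt_of_mem {x₀ x : M} (hx : x ∈ (extChartAt (𝓡 n) x₀).source) :
    ContMDiffAt (𝓡 n) 𝓘(ℝ, EuclideanSpace ℝ (Fin n)) ∞ (extChartAt (𝓡 n) x₀) x :=
  (contMDiffOn_extChartAt (n := ∞)).contMDiffAt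
    ((chartAt _ x₀).open_source.mem_nhds (by simpa [extChartAt_source] using hx))

theorem mfderiv_extChartAt_coordVec {x₀ : M} {y : EuclideanSpace ℝ (Fin n)}
    (hy : y ∈ (extChartAt (𝓡 n) x₀).target) (v : EuclideanSpace ℝ (Fin n)) :
    mfderiv (𝓡 n) 𝓘(ℝ, EuclideanSpace ℝ (Fin n)) (extChartAt (𝓡 n) x₀)
      ((extChartAt (𝓡 n) x₀).symm y) (coordVec x₀ y v) = v := by
  have h1 := (contMDiffAt_extChartAt_symm hy).mdifferentiableAt (by simp)
  have h2 := (contMDiffAt_extChartAt_of_mem ((extChartAt (𝓡 n) x₀).map_target hy)).mdifferentiableAt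
    (by simp)
  have h3 := mfderiv_comp y h2 h1
  have h4 : (extChartAt (𝓡 n) x₀) ∘ (extChartAt (𝓡 n) x₀).symm =ᶠ[𝓝 y] id := by
    filter_upwards [(isOpen_extChartAt_target x₀).mem_nhds hy] with z hz
    exact (extChartAt (𝓡 n) x₀).right_inv hz
  rw [h4.mfderiv_eq, mfderiv_id] at h3
  exact (congrArg (fun l : EuclideanSpace ℝ (Fin n) →L[ℝ] EuclideanSpace ℝ (Fin n) => l v) h3).symm

theorem coordVec_injective {x₀ : M} {y : EuclideanSpace ℝ (Fin n)}
    (hy : y ∈ (extChartAt (𝓡 n) x₀).target) : Function.Injective (coordVec x₀ y) := by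
  intro v w h
  rw [← mfderiv_extChartAt_coordVec hy v, h, mfderiv_extChartAt_coordVec hy w]

end Charts

section LocalRepresentatives

variable {k n : ℕ} {N : Type*} [TopologicalSpace N] [ChartedSpace (EuclideanSpace ℝ (Fin k)) N]
  {M : Type*} [TopologicalSpace M] [ChartedSpace (EuclideanSpace ℝ (Fin n)) M]

variable (k n) in
/-- The local representative of `f` in the charts at `a` and at `b`. -/
noncomputable def localRep (f : N → M) (a : N) (b : M) :
    EuclideanSpace ℝ (Fin k) → EuclideanSpace ℝ (Fin n) :=
  fun y => extChartAt (𝓡 n) b (f ((extChartAt (𝓡 k) a).symm y))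

variable [IsManifold (𝓡 k) ∞ N] [IsManifold (𝓡 n) ∞ M]

theorem contDiffAt_localRep {f : N → M} {a : N} {b : M} {y : EuclideanSpace ℝ (Fin k)}
    (hy : y ∈ (extChartAt (𝓡 k) a).target)
    (hf : ContMDiffAt (𝓡 k) (𝓡 n) ∞ f ((extChartAt (𝓡 k) a).symm y))
    (hb : f ((extChartAt (𝓡 k) a).symm y) ∈ (extChartAt (𝓡 n) b).source) :
    ContDiffAt ℝ ∞ (localRep k n f a b) y := by
  rw [← contMDiffAt_iff_contDiffAt]
  exact (contMDiffAt_extChartAt_of_mem (n := n) (M := M) hb).comp y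
    (hf.comp y (contMDiffAt_extChartAt_symm hy))

/-- The local representative of `f` computes `df` in coordinates. The equation is stated in the
tangent bundle, as the base points are only propositionally equal. -/
theorem coordVec_fderiv_localRep {f : N → M} {a : N} {b : M} {y : EuclideanSpace ℝ (Fin k)}
    (hy : y ∈ (extChartAt (𝓡 k) a).target)
    (hf : ContMDiffAt (𝓡 k) (𝓡 n) ∞ f ((extChartAt (𝓡 k) a).symm y))
    (hb : f ((extChartAt (𝓡 k) a).symm y) ∈ (extChartAt (𝓡 n) b).source)
    (v : EuclideanSpace ℝ (Fin k)) :
    (⟨(extChartAt (𝓡 n) b).symm (localRep k n f a b y),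
      coordVec b (localRep k n f a b y) (fderiv ℝ (localRep k n f a b) y v)⟩ :
      TangentBundle (𝓡 n) M) =
    ⟨f ((extChartAt (𝓡 k) a).symm y),
      mfderiv (𝓡 k) (𝓡 n) f ((extChartAt (𝓡 k) a).symm y) (coordVec a y v)⟩ := by
  have hφ : ContMDiffAt 𝓘(ℝ, EuclideanSpace ℝ (Fin k)) 𝓘(ℝ, EuclideanSpace ℝ (Fin n)) ∞
    (localRep k n f a b) y := contMDiffAt_iff_contDiffAt.2 (contDiffAt_localRep hy hf hb)
  have hs := contMDiffAt_extChartAt_symm hy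
  have ht : ContMDiffAt 𝓘(ℝ, EuclideanSpace ℝ (Fin n)) (𝓡 n) ∞ (extChartAt (𝓡 n) b).symm
    (localRep k n f a b y) := contMDiffAt_extChartAt_symm ((extChartAt (𝓡 n) b).map_source hb)
  have h1 : (extChartAt (𝓡 n) b).symm ∘ localRep k n f a b =ᶠ[𝓝 y]
      f ∘ (extChartAt (𝓡 k) a).symm := by
    have hc : ContinuousAt (fun z => f ((extChartAt (𝓡 k) a).symm z)) y :=
      (hf.comp y hs).continuousAt
    filter_upwards [hc.eventually ((isOpen_extChartAt_source b).mem_nhds hb)] with z hz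
    exact (extChartAt (𝓡 n) b).left_inv hz
  have h2 := tangentMap_comp_at (⟨y, v⟩ : TangentBundle 𝓘(ℝ, EuclideanSpace ℝ (Fin k)) _)
    (ht.mdifferentiableAt (by simp)) (hφ.mdifferentiableAt (by simp))
  have h3 := tangentMap_comp_at (⟨y, v⟩ : TangentBundle 𝓘(ℝ, EuclideanSpace ℝ (Fin k)) _)
    (hf.mdifferentiableAt (by simp)) (hs.mdifferentiableAt (by simp))
  have h4 : tangentMap 𝓘(ℝ, EuclideanSpace ℝ (Fin k)) (𝓡 n)
      ((extChartAt (𝓡 n) b).symm ∘ localRep k n f a b) ⟨y, v⟩ =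
      tangentMap 𝓘(ℝ, EuclideanSpace ℝ (Fin k)) (𝓡 n) (f ∘ (extChartAt (𝓡 k) a).symm) ⟨y, v⟩ := by
    simp only [tangentMap]
    rw [h1.mfderiv_eq]
    exact congrArg (fun p => (⟨p, mfderiv 𝓘(ℝ, EuclideanSpace ℝ (Fin k)) (𝓡 n)
      (f ∘ (extChartAt (𝓡 k) a).symm) y v⟩ : TangentBundle (𝓡 n) M)) h1.self_of_nhds
  rw [h2, h3] at h4
  simp only [tangentMap, mfderiv_eq_fderiv] at h4
  exact h4

end LocalRepresentatives

section Metric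

variable {n : ℕ} {M : Type*} [TopologicalSpace M] [ChartedSpace (EuclideanSpace ℝ (Fin n)) M]
  [RiemannianBundle (fun x : M => TangentSpace (𝓡 n) x)]

theorem metricInChart_eq (x₀ : M) (y v w : EuclideanSpace ℝ (Fin n)) :
    metricInChart x₀ y v w = inner ℝ (coordVec x₀ y v) (coordVec x₀ y w) := rfl

/-- The metric in the chart at `x₀`, as a family of continuous bilinear forms. -/
noncomputable def coordMetric (x₀ : M) (y : EuclideanSpace ℝ (Fin n)) :
    EuclideanSpace ℝ (Fin n) →L[ℝ] EuclideanSpace ℝ (Fin n) →L[ℝ] ℝ :=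
  LinearMap.toContinuousLinearMap
    ((LinearMap.toContinuousLinearMap : (EuclideanSpace ℝ (Fin n) →ₗ[ℝ] ℝ) ≃ₗ[ℝ] _).toLinearMap ∘ₗ
      LinearMap.mk₂ ℝ (metricInChart x₀ y)
        (fun _ _ _ => by simp only [metricInChart_eq, map_add, inner_add_left])
        (fun _ _ _ => by simp only [metricInChart_eq, map_smul, real_inner_smul_left, smul_eq_mul])
        (fun _ _ _ => by simp only [metricInChart_eq, map_add, inner_add_right])
        (fun _ _ _ => by simp only [metricInChart_eq, map_smul, real_inner_smul_right, smul_eq_mul]))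

theorem coordMetric_apply (x₀ : M) (y v w : EuclideanSpace ℝ (Fin n)) :
    coordMetric x₀ y v w = metricInChart x₀ y v w := rfl

theorem coordMetric_symm (x₀ : M) (y v w : EuclideanSpace ℝ (Fin n)) :
    coordMetric x₀ y v w = coordMetric x₀ y w v :=
  real_inner_comm (coordVec x₀ y w) (coordVec x₀ y v)

variable [IsManifold (𝓡 n) ∞ M]

theorem coordMetric_pos {x₀ : M} {y : EuclideanSpace ℝ (Fin n)}
    (hy : y ∈ (extChartAt (𝓡 n) x₀).target) {v : EuclideanSpace ℝ (Fin n)} (hv : v ≠ 0) :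
    0 < coordMetric x₀ y v v := by
  rw [coordMetric_apply, metricInChart_eq, real_inner_self_pos]
  refine fun h => hv ?_
  exact (injective_iff_map_eq_zero (coordVec x₀ y)).1 (coordVec_injective hy) v h

theorem contDiffOn_coordMetric [IsContMDiffRiemannianBundle (𝓡 n) ∞ (EuclideanSpace ℝ (Fin n))
      (fun x : M => TangentSpace (𝓡 n) x)] (x₀ : M) :
    ContDiffOn ℝ ∞ (coordMetric x₀) (extChartAt (𝓡 n) x₀).target := by
  rw [contDiffOn_clm_apply]
  intro v
  rw [contDiffOn_clm_apply]
  intro w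
  have hsec : ∀ v : EuclideanSpace ℝ (Fin n),
      ContMDiffOn 𝓘(ℝ, EuclideanSpace ℝ (Fin n)) ((𝓡 n).prod 𝓘(ℝ, EuclideanSpace ℝ (Fin n))) ∞
        (fun y => (⟨(extChartAt (𝓡 n) x₀).symm y, coordVec x₀ y v⟩ : TangentBundle (𝓡 n) M))
        (extChartAt (𝓡 n) x₀).target := by
    intro v y hy
    have h1 : ContMDiffWithinAt 𝓘(ℝ, EuclideanSpace ℝ (Fin n))
        ((𝓡 n).prod 𝓘(ℝ, EuclideanSpace ℝ (Fin n))) ∞ _ _ y :=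
      ((contMDiffOn_extChartAt_symm (n := ∞) (I := 𝓡 n) x₀).contMDiffOn_tangentMapWithin (m := ∞)
      (by simp) (isOpen_extChartAt_target x₀).uniqueMDiffOn).comp
      (t := TotalSpace.proj ⁻¹' (extChartAt (𝓡 n) x₀).target)
      (s := (extChartAt (𝓡 n) x₀).target) (f := fun y => (⟨y, v⟩ :
        TangentBundle 𝓘(ℝ, EuclideanSpace ℝ (Fin n)) (EuclideanSpace ℝ (Fin n))))
      ((contMDiff_vectorSpace_iff_contDiff (V := fun _ => v)).2 contDiff_const).contMDiffOn
      (fun y hy => hy) y hy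
    refine h1.congr (fun z hz => ?_) ?_
    all_goals
      simp only [Function.comp_apply, tangentMapWithin]
      rw [mfderivWithin_of_isOpen (isOpen_extChartAt_target x₀) (by assumption)]
      rfl
  rw [← contMDiffOn_iff_contDiffOn]
  exact (hsec v).inner_bundle (hsec w)

end Metric

/-! ### Geodesics: independence of charts, uniqueness, behaviour under isometries -/

theorem two_le_infty : (2 : WithTop ℕ∞) ≤ ∞ :=
  WithTop.coe_le_coe.2 (le_top : (2 : ℕ∞) ≤ ⊤)

theorem geodesicExpr_congr {E : Type*} [NormedAddCommGroup E] [NormedSpace ℝ E]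
    {g : E → E → E → ℝ} {u₁ u₂ : ℝ → E} {t : ℝ} (h : u₁ =ᶠ[𝓝 t] u₂) (w : E) :
    geodesicExpr g u₁ t w = geodesicExpr g u₂ t w := by
  simp only [geodesicExpr, h.self_of_nhds, h.deriv_eq, h.deriv.deriv_eq]

section Pullback

variable {k n : ℕ} {N : Type*} [TopologicalSpace N] [ChartedSpace (EuclideanSpace ℝ (Fin k)) N]
  [IsManifold (𝓡 k) ∞ N] [RiemannianBundle (fun x : N => TangentSpace (𝓡 k) x)]
  {M : Type*} [TopologicalSpace M] [ChartedSpace (EuclideanSpace ℝ (Fin n)) M]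
  [IsManifold (𝓡 n) ∞ M] [RiemannianBundle (fun x : M => TangentSpace (𝓡 n) x)]

omit [IsManifold (𝓡 n) ∞ M] in
theorem inner_eq_of_mk_eq {x y : M} {v₁ w₁ : TangentSpace (𝓡 n) x} {v₂ w₂ : TangentSpace (𝓡 n) y}
    (hv : (⟨x, v₁⟩ : TangentBundle (𝓡 n) M) = ⟨y, v₂⟩)
    (hw : (⟨x, w₁⟩ : TangentBundle (𝓡 n) M) = ⟨y, w₂⟩) : inner ℝ v₁ w₁ = inner ℝ v₂ w₂ := by
  cases hv
  cases hw
  rfl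

theorem metricInChart_eq_pullback {f : N → M} (hf : ContMDiff (𝓡 k) (𝓡 n) ∞ f)
    (hfm : PreservesMetric (k := k) (n := n) f) {a : N} {b : M} {y : EuclideanSpace ℝ (Fin k)}
    (hy : y ∈ (extChartAt (𝓡 k) a).target)
    (hb : f ((extChartAt (𝓡 k) a).symm y) ∈ (extChartAt (𝓡 n) b).source)
    (v w : EuclideanSpace ℝ (Fin k)) :
    metricInChart a y v w = coordMetric b (localRep k n f a b y)
      (fderiv ℝ (localRep k n f a b) y v) (fderiv ℝ (localRep k n f a b) y w) := by
  rw [metricInChart_eq, coordMetric_apply, metricInChart_eq,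
    inner_eq_of_mk_eq (coordVec_fderiv_localRep hy (hf _) hb v)
      (coordVec_fderiv_localRep hy (hf _) hb w), hfm]

/-- A smooth map preserving the metrics (between manifolds of possibly different dimensions)
pulls back the geodesic expression of `f ∘ c` to that of `c`. -/
theorem geodesicExpr_comp [IsContMDiffRiemannianBundle (𝓡 n) ∞ (EuclideanSpace ℝ (Fin n))
      (fun x : M => TangentSpace (𝓡 n) x)]
    {f : N → M} (hf : ContMDiff (𝓡 k) (𝓡 n) ∞ f)
    (hfm : PreservesMetric (k := k) (n := n) f) {c : ℝ → N} {t : ℝ}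
    (hc : ContMDiffAt 𝓘(ℝ, ℝ) (𝓡 k) 2 c t) {a : N} {b : M}
    (ha : c t ∈ (extChartAt (𝓡 k) a).source) (hb : f (c t) ∈ (extChartAt (𝓡 n) b).source)
    (w : EuclideanSpace ℝ (Fin k)) :
    geodesicExpr (metricInChart a) (fun s => extChartAt (𝓡 k) a (c s)) t w =
      geodesicExpr (metricInChart b) (fun s => extChartAt (𝓡 n) b (f (c s))) t
        (fderiv ℝ (localRep k n f a b) (extChartAt (𝓡 k) a (c t)) w) := by
  have hy := (extChartAt (𝓡 k) a).map_source ha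
  have hsymm := (extChartAt (𝓡 k) a).left_inv ha
  have hb' : f ((extChartAt (𝓡 k) a).symm (extChartAt (𝓡 k) a (c t))) ∈
    (extChartAt (𝓡 n) b).source := by rwa [hsymm]
  have hφ := (contDiffAt_localRep hy (hf _) hb').of_le (m := 2) two_le_infty
  have hφt : localRep k n f a b (extChartAt (𝓡 k) a (c t)) ∈ (extChartAt (𝓡 n) b).target :=
    (extChartAt (𝓡 n) b).map_source hb'
  have hB : DifferentiableAt ℝ (coordMetric b)
      (localRep k n f a b (extChartAt (𝓡 k) a (c t))) :=
    ((contDiffOn_coordMetric b).contDiffAt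
      ((isOpen_extChartAt_target b).mem_nhds hφt)).differentiableAt (by simp)
  have hu : ContDiffAt ℝ 2 (fun s => extChartAt (𝓡 k) a (c s)) t := by
    rw [← contMDiffAt_iff_contDiffAt]
    exact ((contMDiffAt_extChartAt_of_mem ha).of_le two_le_infty).comp t hc
  have hcomp : (localRep k n f a b) ∘ (fun s => extChartAt (𝓡 k) a (c s)) =ᶠ[𝓝 t]
      fun s => extChartAt (𝓡 n) b (f (c s)) := by
    filter_upwards [hc.continuousAt.eventually ((isOpen_extChartAt_source a).mem_nhds ha)]
      with s hs
    simp only [Function.comp_apply, localRep, (extChartAt (𝓡 k) a).left_inv hs]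
  rw [← geodesicExpr_congr hcomp]
  refine geodesicExpr_pullback hB (coordMetric_symm b _) hφ hu ?_ w
  have hcont : ContinuousAt (fun z => f ((extChartAt (𝓡 k) a).symm z)) (extChartAt (𝓡 k) a (c t)) :=
    ((hf _).comp _ (contMDiffAt_extChartAt_symm hy)).continuousAt
  filter_upwards [(isOpen_extChartAt_target a).mem_nhds hy,
    hcont.eventually ((isOpen_extChartAt_source b).mem_nhds hb')] with z hz hz' v w
  exact metricInChart_eq_pullback hf hfm hz hz' v w

end Pullback

section Geodesic

variable {n : ℕ} {M : Type*} [TopologicalSpace M] [ChartedSpace (EuclideanSpace ℝ (Fin n)) M]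
  [RiemannianBundle (fun x : M => TangentSpace (𝓡 n) x)]

theorem isGeodesicOn_iff {γ : ℝ → M} {J : Set ℝ} : IsGeodesicOn (n := n) γ J ↔
    ContMDiffOn 𝓘(ℝ, ℝ) (𝓡 n) 2 γ J ∧ ∀ t ∈ J, ∀ w : EuclideanSpace ℝ (Fin n),
      geodesicExpr (metricInChart (γ t)) (fun s => extChartAt (𝓡 n) (γ t) (γ s)) t w = 0 := Iff.rfl

theorem preservesMetric_id : PreservesMetric (k := n) (n := n) (id : M → M) := by
  intro x v w
  rw [mfderiv_id]
  rfl

theorem PreservesMetric.comp {k m : ℕ} {N : Type*} [TopologicalSpace N]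
    [ChartedSpace (EuclideanSpace ℝ (Fin k)) N]
    [RiemannianBundle (fun x : N => TangentSpace (𝓡 k) x)]
    {P : Type*} [TopologicalSpace P]
    [ChartedSpace (EuclideanSpace ℝ (Fin m)) P]
    [RiemannianBundle (fun x : P => TangentSpace (𝓡 m) x)]
    {g : N → M} {f : P → N} (hg : PreservesMetric (k := k) (n := n) g)
    (hf : PreservesMetric (k := m) (n := k) f) (hg' : MDifferentiable (𝓡 k) (𝓡 n) g)
    (hf' : MDifferentiable (𝓡 m) (𝓡 k) f) : PreservesMetric (k := m) (n := n) (g ∘ f) := by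
  intro x v w
  rw [mfderiv_comp x (hg' _) (hf' _)]
  exact (hg _ _ _).trans (hf _ _ _)

theorem IsGeodesicOn.congr {γ₁ γ₂ : ℝ → M} {J : Set ℝ} (hJ : IsOpen J)
    (h : IsGeodesicOn (n := n) γ₁ J) (he : EqOn γ₁ γ₂ J) : IsGeodesicOn (n := n) γ₂ J := by
  refine isGeodesicOn_iff.2 ⟨h.1.congr fun t ht => (he ht).symm, fun t ht w => ?_⟩
  rw [← he ht]
  refine (geodesicExpr_congr ?_ w).trans ((isGeodesicOn_iff.1 h).2 t ht w)
  filter_upwards [hJ.mem_nhds ht] with s hs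
  rw [he hs]

theorem IsGeodesicOn.mono {γ : ℝ → M} {J J' : Set ℝ} (h : IsGeodesicOn (n := n) γ J)
    (hJ : J' ⊆ J) : IsGeodesicOn (n := n) γ J' :=
  ⟨h.1.mono hJ, fun t ht => h.2 t (hJ ht)⟩

/-- Affine reparametrization of a geodesic by a reflection of the line. -/
theorem IsGeodesicOn.comp_const_sub {γ : ℝ → M} {J J' : Set ℝ} (h : IsGeodesicOn (n := n) γ J)
    (a : ℝ) (hJ : ∀ t ∈ J', a - t ∈ J) : IsGeodesicOn (n := n) (fun t => γ (a - t)) J' := by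
  refine isGeodesicOn_iff.2 ⟨h.1.comp (ContDiff.contMDiff (by fun_prop)).contMDiffOn hJ,
    fun t ht w => ?_⟩
  have h1 := (isGeodesicOn_iff.1 h).2 _ (hJ t ht) w
  let u : ℝ → EuclideanSpace ℝ (Fin n) := fun s => extChartAt (𝓡 n) (γ (a - t)) (γ s)
  have h2 : ∀ s, deriv (fun s => u (a - s)) s = -deriv u (a - s) := fun s =>
    deriv_comp_const_sub u a s
  have h3 : deriv (deriv (fun s => u (a - s))) t = deriv (deriv u) (a - t) := by
    rw [funext h2, deriv.fun_neg, deriv_comp_const_sub, neg_neg]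
  rw [← h1]
  change geodesicExpr _ (fun s => u (a - s)) t w = geodesicExpr _ u (a - t) w
  simp only [geodesicExpr, h3, h2, christoffel, metricInChart_eq, map_neg, inner_neg_left,
    inner_neg_right, neg_neg]
  have h4 : ∀ (g : EuclideanSpace ℝ (Fin n) → ℝ) (y : EuclideanSpace ℝ (Fin n)),
      fderiv ℝ (fun z => -g z) y = -fderiv ℝ g y := fun g y => fderiv_fun_neg
  simp only [h4, neg_apply, neg_neg]

variable [IsManifold (𝓡 n) ∞ M] [IsContMDiffRiemannianBundle (𝓡 n) ∞ (EuclideanSpace ℝ (Fin n))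
      (fun x : M => TangentSpace (𝓡 n) x)]

/-- The geodesic equation holds in every chart. -/
theorem IsGeodesicOn.geodesicExpr_eq_zero {γ : ℝ → M} {J : Set ℝ} (hJ : IsOpen J)
    (h : IsGeodesicOn (n := n) γ J) {t : ℝ} (ht : t ∈ J) {a : M}
    (ha : γ t ∈ (extChartAt (𝓡 n) a).source) (w : EuclideanSpace ℝ (Fin n)) :
    geodesicExpr (metricInChart a) (fun s => extChartAt (𝓡 n) a (γ s)) t w = 0 :=
  (geodesicExpr_comp contMDiff_id preservesMetric_id (h.1.contMDiffAt (hJ.mem_nhds ht)) ha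
    (mem_extChartAt_source (I := 𝓡 n) (γ t)) w).trans ((isGeodesicOn_iff.1 h).2 t ht _)

/-- It is enough to check the geodesic equation in one chart. -/
theorem isGeodesicOn_of_chart {γ : ℝ → M} {J : Set ℝ} (hJ : IsOpen J)
    (hγ : ContMDiffOn 𝓘(ℝ, ℝ) (𝓡 n) 2 γ J) {a : M}
    (ha : ∀ t ∈ J, γ t ∈ (extChartAt (𝓡 n) a).source)
    (h : ∀ t ∈ J, ∀ w, geodesicExpr (metricInChart a) (fun s => extChartAt (𝓡 n) a (γ s)) t w = 0) :
    IsGeodesicOn (n := n) γ J :=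
  isGeodesicOn_iff.2 ⟨hγ, fun t ht w => (geodesicExpr_comp contMDiff_id preservesMetric_id
    (hγ.contMDiffAt (hJ.mem_nhds ht)) (mem_extChartAt_source (I := 𝓡 n) (γ t)) (ha t ht) w).trans
      (h t ht _)⟩

/-- If `f` preserves the metrics and `f ∘ c` is a geodesic, then so is `c`. -/
theorem IsGeodesicOn.of_comp {k : ℕ} {N : Type*} [TopologicalSpace N]
    [ChartedSpace (EuclideanSpace ℝ (Fin k)) N] [IsManifold (𝓡 k) ∞ N]
    [RiemannianBundle (fun x : N => TangentSpace (𝓡 k) x)]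
    {f : N → M} (hf : ContMDiff (𝓡 k) (𝓡 n) ∞ f) (hfm : PreservesMetric (k := k) (n := n) f)
    {c : ℝ → N} {J : Set ℝ} (hJ : IsOpen J) (hc : ContMDiffOn 𝓘(ℝ, ℝ) (𝓡 k) 2 c J)
    (h : IsGeodesicOn (n := n) (fun t => f (c t)) J) : IsGeodesicOn (n := k) c J :=
  isGeodesicOn_iff.2 ⟨hc, fun t ht w => (geodesicExpr_comp hf hfm (hc.contMDiffAt (hJ.mem_nhds ht))
    (mem_extChartAt_source (I := 𝓡 k) (c t)) (mem_extChartAt_source (I := 𝓡 n) (f (c t))) w).trans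
      ((isGeodesicOn_iff.1 h).2 t ht _)⟩

omit [IsManifold (𝓡 n) ∞ M] [IsContMDiffRiemannianBundle (𝓡 n) ∞ (EuclideanSpace ℝ (Fin n))
      (fun x : M => TangentSpace (𝓡 n) x)] in
theorem preservesMetric_diffeomorph_symm {φ : M ≃ₘ^∞⟮𝓡 n, 𝓡 n⟯ M}
    (h : PreservesMetric (k := n) (n := n) φ) : PreservesMetric (k := n) (n := n) φ.symm := by
  intro x v w
  have hid : ∀ v : TangentSpace (𝓡 n) x, (⟨φ (φ.symm x), mfderiv (𝓡 n) (𝓡 n) φ (φ.symm x)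
      (mfderiv (𝓡 n) (𝓡 n) φ.symm x v)⟩ : TangentBundle (𝓡 n) M) = ⟨x, v⟩ := by
    intro v
    have h1 := tangentMap_comp_at (⟨x, v⟩ : TangentBundle (𝓡 n) M)
      (φ.mdifferentiable (by simp) (φ.symm x)) (φ.symm.mdifferentiable (by simp) x)
    have h2 : φ ∘ φ.symm = id := funext φ.apply_symm_apply
    rw [h2, tangentMap_id] at h1
    exact h1.symm
  rw [← h]
  exact inner_eq_of_mk_eq (hid v) (hid w)

theorem IsGeodesicOn.map_isometry {φ : M ≃ₘ^∞⟮𝓡 n, 𝓡 n⟯ M}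
    (hφ : PreservesMetric (k := n) (n := n) φ) {γ : ℝ → M} {J : Set ℝ} (hJ : IsOpen J)
    (h : IsGeodesicOn (n := n) γ J) : IsGeodesicOn (n := n) (fun t => φ (γ t)) J := by
  refine IsGeodesicOn.of_comp φ.symm.contMDiff (preservesMetric_diffeomorph_symm hφ) hJ
    ((φ.contMDiff.of_le two_le_infty).comp_contMDiffOn h.1) ?_
  simpa using h

omit [RiemannianBundle (fun x : M => TangentSpace (𝓡 n) x)]
  [IsContMDiffRiemannianBundle (𝓡 n) ∞ (EuclideanSpace ℝ (Fin n))
      (fun x : M => TangentSpace (𝓡 n) x)] in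
theorem deriv_extChartAt_comp {γ : ℝ → M} {t : ℝ} (hγ : MDifferentiableAt 𝓘(ℝ, ℝ) (𝓡 n) γ t) {a : M}
    (ha : γ t ∈ (extChartAt (𝓡 n) a).source) :
    (⟨extChartAt (𝓡 n) a (γ t), deriv (fun s => extChartAt (𝓡 n) a (γ s)) t⟩ :
      TangentBundle 𝓘(ℝ, EuclideanSpace ℝ (Fin n)) (EuclideanSpace ℝ (Fin n))) =
      tangentMap (𝓡 n) 𝓘(ℝ, EuclideanSpace ℝ (Fin n)) (extChartAt (𝓡 n) a)
        (tangentMap 𝓘(ℝ, ℝ) (𝓡 n) γ ⟨t, (1 : ℝ)⟩) := by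
  rw [← tangentMap_comp_at (⟨t, (1 : ℝ)⟩ : TangentBundle 𝓘(ℝ, ℝ) ℝ)
    ((contMDiffAt_extChartAt_of_mem (n := n) (M := M) ha).mdifferentiableAt (by simp)) hγ]
  simp only [tangentMap, mfderiv_eq_fderiv]
  rfl

/-- Local uniqueness of geodesics, with the initial velocities compared in a chart. -/
theorem IsGeodesicOn.eventuallyEq {γ₁ γ₂ : ℝ → M} {J : Set ℝ} (hJ : IsOpen J)
    (h₁ : IsGeodesicOn (n := n) γ₁ J) (h₂ : IsGeodesicOn (n := n) γ₂ J) {t : ℝ} (ht : t ∈ J) {a : M}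
    (ha : γ₁ t ∈ (extChartAt (𝓡 n) a).source) (h0 : γ₁ t = γ₂ t)
    (h1 : deriv (fun s => extChartAt (𝓡 n) a (γ₁ s)) t =
      deriv (fun s => extChartAt (𝓡 n) a (γ₂ s)) t) : γ₁ =ᶠ[𝓝 t] γ₂ := by
  obtain ⟨X, hX, hXs⟩ := exists_geodesicSpray (isOpen_extChartAt_target a)
    (contDiffOn_coordMetric a) (fun y hy v hv => coordMetric_pos (n := n) (M := M) hy hv)
  have key : ∀ γ : ℝ → M, IsGeodesicOn (n := n) γ J → γ t = γ₁ t →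
      ContDiffAt ℝ 2 (fun s => extChartAt (𝓡 n) a (γ s)) t ∧
      (∀ᶠ s in 𝓝 t, γ s ∈ (extChartAt (𝓡 n) a).source) ∧
      ∀ᶠ s in 𝓝 t, deriv (deriv fun s => extChartAt (𝓡 n) a (γ s)) s =
        X (extChartAt (𝓡 n) a (γ s), deriv (fun s => extChartAt (𝓡 n) a (γ s)) s) := by
    intro γ h hγ
    have hγt : γ t ∈ (extChartAt (𝓡 n) a).source := hγ ▸ ha
    have hc := h.1.contMDiffAt (hJ.mem_nhds ht)
    have hs : ∀ᶠ s in 𝓝 t, γ s ∈ (extChartAt (𝓡 n) a).source :=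
      hc.continuousAt.eventually ((isOpen_extChartAt_source a).mem_nhds hγt)
    refine ⟨?_, hs, ?_⟩
    · rw [← contMDiffAt_iff_contDiffAt]
      exact ((contMDiffAt_extChartAt_of_mem hγt).of_le two_le_infty).comp t hc
    · filter_upwards [hs, hJ.mem_nhds ht] with s hs1 hs2
      exact ((hXs _ ((extChartAt (𝓡 n) a).map_source hs1)).2 _ _).1 fun w =>
        h.geodesicExpr_eq_zero hJ hs2 hs1 w
  obtain ⟨k1, k1', k1''⟩ := key γ₁ h₁ rfl
  obtain ⟨k2, k2', k2''⟩ := key γ₂ h₂ h0.symm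
  have hXat : ContDiffAt ℝ 1 X
      (extChartAt (𝓡 n) a (γ₁ t), deriv (fun s => extChartAt (𝓡 n) a (γ₁ s)) t) :=
    (hX.contDiffAt (((isOpen_extChartAt_target a).prod isOpen_univ).mem_nhds
      ⟨(extChartAt (𝓡 n) a).map_source ha, mem_univ _⟩)).of_le (mod_cast le_top)
  have := eventuallyEq_of_deriv_deriv_eq hXat k1 k2 k1'' k2'' (congrArg _ h0) h1
  filter_upwards [this, k1', k2'] with s hs hs1 hs2
  exact (extChartAt (𝓡 n) a).injOn hs1 hs2 hs

/-- Uniqueness of geodesics on an interval. -/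
theorem IsGeodesicOn.eqOn [T2Space M] {γ₁ γ₂ : ℝ → M} {J : Set ℝ} (hJ : IsOpen J)
    (hJc : IsPreconnected J) (h₁ : IsGeodesicOn (n := n) γ₁ J) (h₂ : IsGeodesicOn (n := n) γ₂ J)
    {t₀ : ℝ} (ht₀ : t₀ ∈ J)
    (h0 : tangentMap 𝓘(ℝ, ℝ) (𝓡 n) γ₁ ⟨t₀, (1 : ℝ)⟩ = tangentMap 𝓘(ℝ, ℝ) (𝓡 n) γ₂ ⟨t₀, (1 : ℝ)⟩) :
    EqOn γ₁ γ₂ J := by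
  have hmd : ∀ γ : ℝ → M, IsGeodesicOn (n := n) γ J → ∀ t ∈ J, ContMDiffAt 𝓘(ℝ, ℝ) (𝓡 n) 2 γ t :=
    fun γ h t ht => h.1.contMDiffAt (hJ.mem_nhds ht)
  let S : Set ℝ := {t | γ₁ =ᶠ[𝓝 t] γ₂}
  have hSo : IsOpen S := isOpen_iff_mem_nhds.2 fun t ht => eventually_eventually_nhds.2 ht
  have ht₀S : t₀ ∈ S := by
    have hp : γ₁ t₀ = γ₂ t₀ := congrArg TotalSpace.proj h0
    have hs := mem_extChartAt_source (I := 𝓡 n) (γ₁ t₀)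
    refine h₁.eventuallyEq hJ h₂ ht₀ hs hp ?_
    have e1 := deriv_extChartAt_comp ((hmd γ₁ h₁ t₀ ht₀).mdifferentiableAt (by simp)) hs
    have e2 := deriv_extChartAt_comp (a := γ₁ t₀)
      ((hmd γ₂ h₂ t₀ ht₀).mdifferentiableAt (by simp)) (hp ▸ hs)
    rw [h0, ← e2] at e1
    exact eq_of_heq (TotalSpace.mk.inj e1).2
  -- the set where the two geodesics agree locally is closed in `J`, as positions and velocities
  -- agree at its limit points
  have hsub : J ⊆ S := by
    refine hJc.subset_of_closure_inter_subset hSo ⟨t₀, ht₀, ht₀S⟩ ?_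
    rintro t ⟨htc, htJ⟩
    have hfr : ∃ᶠ s in 𝓝 t, s ∈ S := mem_closure_iff_frequently.1 htc
    have hp : γ₁ t = γ₂ t := by
      by_contra hne
      have hev := ((hmd γ₁ h₁ t htJ).continuousAt.ne_iff_eventually_ne
        (hmd γ₂ h₂ t htJ).continuousAt).1 hne
      obtain ⟨s, hs, hs'⟩ := (hfr.and_eventually hev).exists
      exact hs' (Filter.EventuallyEq.eq_of_nhds hs)
    have hs := mem_extChartAt_source (I := 𝓡 n) (γ₁ t)
    refine h₁.eventuallyEq hJ h₂ htJ hs hp ?_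
    have hcont : ∀ γ : ℝ → M, IsGeodesicOn (n := n) γ J → γ t = γ₁ t →
        ContinuousAt (deriv fun s => extChartAt (𝓡 n) (γ₁ t) (γ s)) t := by
      intro γ h hγ
      have hu : ContDiffAt ℝ 2 (fun s => extChartAt (𝓡 n) (γ₁ t) (γ s)) t := by
        rw [← contMDiffAt_iff_contDiffAt]
        exact ((contMDiffAt_extChartAt_of_mem (hγ ▸ hs)).of_le two_le_infty).comp t
          (hmd γ h t htJ)
      exact (hu.fderiv_right (m := 1) (by norm_num)).continuousAt.clm_apply continuousAt_const
    by_contra hne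
    have hev := ((hcont γ₁ h₁ rfl).ne_iff_eventually_ne (hcont γ₂ h₂ hp.symm)).1 hne
    obtain ⟨s, hs, hs'⟩ := (hfr.and_eventually hev).exists
    refine hs' (Filter.EventuallyEq.deriv_eq ?_)
    filter_upwards [hs] with r hr
    rw [hr]
  exact fun t ht => Filter.EventuallyEq.eq_of_nhds (hsub ht)

end Geodesic

/-! ### Homogeneity of symmetric spaces and the isotropy action -/

section Homogeneity

variable {n : ℕ} {M : Type*} [TopologicalSpace M] [ChartedSpace (EuclideanSpace ℝ (Fin n)) M]
  [RiemannianBundle (fun x : M => TangentSpace (𝓡 n) x)]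

theorem contDiffOn_two_of_hasDerivAt {E : Type*} [NormedAddCommGroup E] [NormedSpace ℝ E]
    {J : Set ℝ} (hJ : IsOpen J) {x y z : ℝ → E} (hx : ∀ s ∈ J, HasDerivAt x (y s) s)
    (hy : ∀ s ∈ J, HasDerivAt y (z s) s) (hz : ContinuousOn z J) : ContDiffOn ℝ 2 x J := by
  have h1 : ContDiffOn ℝ 1 y J := by
    rw [show (1 : WithTop ℕ∞) = 0 + 1 from rfl, contDiffOn_succ_iff_deriv_of_isOpen hJ]
    refine ⟨fun s hs => (hy s hs).differentiableAt.differentiableWithinAt, by simp, ?_⟩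
    exact contDiffOn_zero.2 (hz.congr fun s hs => (hy s hs).deriv)
  rw [show (2 : WithTop ℕ∞) = 1 + 1 from rfl, contDiffOn_succ_iff_deriv_of_isOpen hJ]
  refine ⟨fun s hs => (hx s hs).differentiableAt.differentiableWithinAt, by simp, ?_⟩
  exact h1.congr fun s hs => (hx s hs).deriv

variable [IsManifold (𝓡 n) ∞ M]

/-- Nearby points are joined by a geodesic. -/
theorem exists_geodesic_through [IsContMDiffRiemannianBundle (𝓡 n) ∞ (EuclideanSpace ℝ (Fin n))
      (fun x : M => TangentSpace (𝓡 n) x)] (p : M) :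
    ∃ τ ε : ℝ, 0 < τ ∧ τ < ε ∧ ∀ᶠ q in 𝓝 p, ∃ γ : ℝ → M,
      γ 0 = p ∧ γ τ = q ∧ IsGeodesicOn (n := n) γ (Ioo (-ε) ε) := by
  obtain ⟨X, hX, hXs⟩ := exists_geodesicSpray (isOpen_extChartAt_target p)
    (contDiffOn_coordMetric p) (fun y hy v hv => coordMetric_pos (n := n) (M := M) hy hv)
  have hpt := mem_extChartAt_target (I := 𝓡 n) p
  have hopen : IsOpen ((extChartAt (𝓡 n) p).target ×ˢ (univ : Set (EuclideanSpace ℝ (Fin n)))) :=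
    (isOpen_extChartAt_target p).prod isOpen_univ
  have hV : (extChartAt (𝓡 n) p).target ×ˢ (univ : Set (EuclideanSpace ℝ (Fin n))) ∈
      𝓝 (extChartAt (𝓡 n) p p, (0 : EuclideanSpace ℝ (Fin n))) :=
    hopen.mem_nhds ⟨hpt, mem_univ _⟩
  obtain ⟨τ, ε, hτ, hτε, h⟩ := exists_solution_through
    ((hX.contDiffAt hV).of_le (mod_cast le_top)) (hXs _ hpt).1 hV
  refine ⟨τ, ε, hτ, hτε, ?_⟩
  filter_upwards [(continuousAt_extChartAt (I := 𝓡 n) p).eventually h,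
    extChartAt_source_mem_nhds (I := 𝓡 n) p] with q hq hqs
  obtain ⟨x, y, hx0, hxτ, hxy⟩ := hq
  have hxt : ∀ s ∈ Ioo (-ε) ε, x s ∈ (extChartAt (𝓡 n) p).target := fun s hs => (hxy s hs).1.1
  have hx2 : ContDiffOn ℝ 2 x (Ioo (-ε) ε) := by
    refine contDiffOn_two_of_hasDerivAt isOpen_Ioo (fun s hs => (hxy s hs).2.1)
      (fun s hs => (hxy s hs).2.2) ?_
    refine hX.continuousOn.comp (fun s hs => ?_) fun s hs => (hxy s hs).1
    exact ((hxy s hs).2.1.continuousAt.prodMk (hxy s hs).2.2.continuousAt).continuousWithinAt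
  refine ⟨fun s => (extChartAt (𝓡 n) p).symm (x s), ?_, ?_, ?_⟩
  · simp only [hx0, extChartAt_to_inv]
  · simp only [hxτ, (extChartAt (𝓡 n) p).left_inv hqs]
  · refine isGeodesicOn_of_chart isOpen_Ioo (a := p) (fun s hs => ?_)
      (fun s hs => (extChartAt (𝓡 n) p).map_target (hxt s hs)) fun s hs w => ?_
    · exact (((contMDiffAt_extChartAt_symm (hxt s hs)).of_le two_le_infty).comp s
        (hx2.contMDiffOn.contMDiffAt (isOpen_Ioo.mem_nhds hs))).contMDiffWithinAt
    · have hev : (fun s => extChartAt (𝓡 n) p ((extChartAt (𝓡 n) p).symm (x s))) =ᶠ[𝓝 s] x := by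
        filter_upwards [isOpen_Ioo.mem_nhds hs] with r hr
        exact (extChartAt (𝓡 n) p).right_inv (hxt r hr)
      have hdx : deriv x =ᶠ[𝓝 s] y := by
        filter_upwards [isOpen_Ioo.mem_nhds hs] with r hr
        exact (hxy r hr).2.1.deriv
      rw [geodesicExpr_congr hev]
      refine ((hXs _ (hxt s hs)).2 _ _).2 ?_ w
      rw [hdx.deriv_eq, hdx.self_of_nhds]
      exact (hxy s hs).2.2.deriv

/-- The symmetry at the midpoint of a geodesic segment interchanges its endpoints. -/
theorem eventually_exists_isometry_apply_eq [T2Space M]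
    [IsContMDiffRiemannianBundle (𝓡 n) ∞ (EuclideanSpace ℝ (Fin n))
      (fun x : M => TangentSpace (𝓡 n) x)] (hsym : IsRiemannianSymmetric (n := n) M) (p : M) :
    ∀ᶠ q in 𝓝 p, ∃ φ : M ≃ₘ^∞⟮𝓡 n, 𝓡 n⟯ M,
      PreservesMetric (k := n) (n := n) (φ : M → M) ∧ φ p = q := by
  obtain ⟨τ, ε, hτ, hτε, h⟩ := exists_geodesic_through (n := n) p
  filter_upwards [h] with q hq
  obtain ⟨γ, hγ0, hγτ, hγ⟩ := hq
  obtain ⟨s, ⟨φ, hφ, hsφ⟩, hs⟩ := hsym.2 (γ (τ / 2))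
  refine ⟨φ, hφ, ?_⟩
  -- the interval `(τ - ε, ε)` is symmetric about `τ / 2`, and both `φ ∘ γ` and the reversed geodesic
  -- are defined on it, with the same velocity at `τ / 2`
  have hsub : Ioo (τ - ε) ε ⊆ Ioo (-ε) ε := fun t ht => ⟨by linarith [ht.1], ht.2⟩
  have hmid : τ / 2 ∈ Ioo (τ - ε) ε := ⟨by linarith, by linarith⟩
  have h1 : IsGeodesicOn (n := n) (fun t => φ (γ t)) (Ioo (τ - ε) ε) :=
    (hγ.mono hsub).map_isometry hφ isOpen_Ioo
  have h2 : IsGeodesicOn (n := n) (fun t => γ (τ - t)) (Ioo (τ - ε) ε) :=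
    hγ.comp_const_sub τ fun t ht => ⟨by linarith [ht.2], by linarith [ht.1]⟩
  have hγd : ∀ t ∈ Ioo (-ε) ε, MDifferentiableAt 𝓘(ℝ, ℝ) (𝓡 n) γ t := fun t ht =>
    (hγ.1.contMDiffAt (isOpen_Ioo.mem_nhds ht)).mdifferentiableAt (by simp)
  have key : tangentMap 𝓘(ℝ, ℝ) (𝓡 n) (fun t => φ (γ t)) ⟨τ / 2, (1 : ℝ)⟩ =
      tangentMap 𝓘(ℝ, ℝ) (𝓡 n) (fun t => γ (τ - t)) ⟨τ / 2, (1 : ℝ)⟩ := by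
    have e1 := tangentMap_comp_at (⟨τ / 2, (1 : ℝ)⟩ : TangentBundle 𝓘(ℝ, ℝ) ℝ)
      (φ.mdifferentiable (by simp) (γ (τ / 2))) (hγd _ (hsub hmid))
    have hrefl : HasDerivAt (fun t : ℝ => τ - t) (-1) (τ / 2) := (hasDerivAt_id _).const_sub τ
    have hmid' : τ - τ / 2 = τ / 2 := by ring
    have e2 := tangentMap_comp_at (g := γ) (f := fun t : ℝ => τ - t)
      (⟨τ / 2, (1 : ℝ)⟩ : TangentBundle 𝓘(ℝ, ℝ) ℝ)
      (hγd (τ - τ / 2) (by rw [hmid']; exact hsub hmid))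
      hrefl.differentiableAt.mdifferentiableAt
    have e3 : tangentMap 𝓘(ℝ, ℝ) 𝓘(ℝ, ℝ) (fun t : ℝ => τ - t) ⟨τ / 2, (1 : ℝ)⟩ =
        ⟨τ / 2, (-1 : ℝ)⟩ := by
      have e4 : (mfderiv 𝓘(ℝ, ℝ) 𝓘(ℝ, ℝ) (fun t : ℝ => τ - t) (τ / 2) : ℝ → ℝ) 1 = -1 := by
        rw [mfderiv_eq_fderiv]
        exact hrefl.deriv
      change (⟨τ - τ / 2, (mfderiv 𝓘(ℝ, ℝ) 𝓘(ℝ, ℝ) (fun t : ℝ => τ - t) (τ / 2) : ℝ → ℝ) 1⟩ :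
        TangentBundle 𝓘(ℝ, ℝ) ℝ) = _
      rw [e4]
      exact congrArg (fun r : ℝ => (⟨r, (-1 : ℝ)⟩ : TangentBundle 𝓘(ℝ, ℝ) ℝ)) hmid'
    refine e1.trans (Eq.trans ?_ e2.symm)
    rw [e3]
    have e5 := hs (mfderiv 𝓘(ℝ, ℝ) (𝓡 n) γ (τ / 2) (1 : ℝ))
    rw [hsφ] at e5
    refine e5.trans ?_
    exact congrArg (fun v : EuclideanSpace ℝ (Fin n) =>
      (⟨γ (τ / 2), v⟩ : TangentBundle (𝓡 n) M))
      (map_neg (mfderiv 𝓘(ℝ, ℝ) (𝓡 n) γ (τ / 2)) (1 : ℝ)).symm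
  have := h1.eqOn isOpen_Ioo isPreconnected_Ioo h2 hmid key (show (0 : ℝ) ∈ _ from
    ⟨by linarith, by linarith⟩)
  simpa [hγ0, hγτ] using this

/-- A Riemannian symmetric space is homogeneous. -/
theorem exists_isometry_apply_eq [T2Space M]
    [IsContMDiffRiemannianBundle (𝓡 n) ∞ (EuclideanSpace ℝ (Fin n))
      (fun x : M => TangentSpace (𝓡 n) x)] (hsym : IsRiemannianSymmetric (n := n) M) (p q : M) :
    ∃ φ : M ≃ₘ^∞⟮𝓡 n, 𝓡 n⟯ M, PreservesMetric (k := n) (n := n) (φ : M → M) ∧ φ p = q := by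
  have : ConnectedSpace M := hsym.1
  let O : Set M := {q | ∃ φ : M ≃ₘ^∞⟮𝓡 n, 𝓡 n⟯ M,
    PreservesMetric (k := n) (n := n) (φ : M → M) ∧ φ p = q}
  have htrans : ∀ φ ψ : M ≃ₘ^∞⟮𝓡 n, 𝓡 n⟯ M, PreservesMetric (k := n) (n := n) (φ : M → M) →
      PreservesMetric (k := n) (n := n) (ψ : M → M) →
      PreservesMetric (k := n) (n := n) (φ.trans ψ : M → M) := fun φ ψ hφ hψ =>
    hψ.comp hφ (ψ.mdifferentiable (by simp)) (φ.mdifferentiable (by simp))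
  have hO : IsOpen O := by
    rw [isOpen_iff_mem_nhds]
    rintro q ⟨φ, hφ, rfl⟩
    filter_upwards [eventually_exists_isometry_apply_eq hsym (φ p)] with q' hq'
    obtain ⟨ψ, hψ, rfl⟩ := hq'
    exact ⟨φ.trans ψ, htrans φ ψ hφ hψ, rfl⟩
  have hOc : IsOpen Oᶜ := by
    rw [isOpen_iff_mem_nhds]
    intro q hq
    filter_upwards [eventually_exists_isometry_apply_eq hsym q] with q' hq' hmem
    obtain ⟨ψ, hψ, rfl⟩ := hq'
    obtain ⟨φ, hφ, hφq⟩ := hmem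
    refine hq ⟨φ.trans ψ.symm, htrans φ ψ.symm hφ (preservesMetric_diffeomorph_symm hψ), ?_⟩
    change ψ.symm (φ p) = q
    rw [hφq, ψ.symm_apply_apply]
  have hpO : p ∈ O := ⟨Diffeomorph.refl (𝓡 n) M ∞, preservesMetric_id, rfl⟩
  have : O = univ := IsClopen.eq_univ ⟨isOpen_compl_iff.1 hOc, hO⟩ ⟨p, hpO⟩
  have hq : q ∈ O := this.symm ▸ mem_univ q
  exact hq

end Homogeneity

section Irreducibility

variable {n : ℕ} {M : Type*} [TopologicalSpace M] [ChartedSpace (EuclideanSpace ℝ (Fin n)) M]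
  [RiemannianBundle (fun x : M => TangentSpace (𝓡 n) x)]

theorem id_mem_isometries : ContinuousMap.id M ∈ isometries (n := n) M :=
  ⟨Diffeomorph.refl (𝓡 n) M ∞, preservesMetric_id, rfl⟩

theorem comp_mem_isometries {a b : C(M, M)} (ha : a ∈ isometries (n := n) M)
    (hb : b ∈ isometries (n := n) M) : a.comp b ∈ isometries (n := n) M := by
  obtain ⟨φ, hφ, hφa⟩ := ha
  obtain ⟨ψ, hψ, hψb⟩ := hb
  refine ⟨ψ.trans φ, hφ.comp hψ (φ.mdifferentiable (by simp)) (ψ.mdifferentiable (by simp)), ?_⟩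
  rw [ContinuousMap.coe_comp, hφa, hψb]
  rfl

/-- The identity component is closed under composition: its left translate by an element of its own
is connected and meets it. -/
theorem comp_mem_identityComponent {a b : C(M, M)} (ha : a ∈ identityComponent (n := n) M)
    (hb : b ∈ identityComponent (n := n) M) : a.comp b ∈ identityComponent (n := n) M := by
  have hsub : identityComponent (n := n) M ⊆ isometries (n := n) M :=
    connectedComponentIn_subset _ _
  have hid : ContinuousMap.id M ∈ identityComponent (n := n) M :=
    mem_connectedComponentIn id_mem_isometries
  have hpre : IsPreconnected (a.comp '' identityComponent (n := n) M) :=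
    isPreconnected_connectedComponentIn.image _ (ContinuousMap.continuous_postcomp a).continuousOn
  have ha' : a ∈ a.comp '' identityComponent (n := n) M := ⟨_, hid, a.comp_id⟩
  have h1 := hpre.subset_connectedComponentIn ha' (F := isometries (n := n) M) (by
    rintro _ ⟨c, hc, rfl⟩
    exact comp_mem_isometries (hsub ha) (hsub hc))
  have h2 : connectedComponentIn (isometries (n := n) M) a = identityComponent (n := n) M :=
    (connectedComponentIn_eq ha).symm
  rw [← h2]
  exact h1 ⟨b, hb, rfl⟩

/-- In an irreducible space, the isotropy group moves a given nonzero subspace of a tangent space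
out of a given proper one. -/
theorem exists_isometry_not_mem (hirr : IsIrreducible (n := n) M) (p : M)
    {V W : Submodule ℝ (TangentSpace (𝓡 n) p)} (hV : V ≠ ⊥) (hW : W ≠ ⊤) :
    ∃ φ : M ≃ₘ^∞⟮𝓡 n, 𝓡 n⟯ M, PreservesMetric (k := n) (n := n) (φ : M → M) ∧
      ∃ v ∈ V, ∃ w, w ∉ W ∧ tangentMap (𝓡 n) (𝓡 n) φ ⟨p, v⟩ = ⟨p, w⟩ := by
  by_contra! H
  have hsub : identityComponent (n := n) M ⊆ isometries (n := n) M :=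
    connectedComponentIn_subset _ _
  let T : Set (TangentSpace (𝓡 n) p) := {w | ∃ a ∈ identityComponent (n := n) M, ∃ v ∈ V,
    tangentMap (𝓡 n) (𝓡 n) a ⟨p, v⟩ = ⟨p, w⟩}
  have hTW : Submodule.span ℝ T ≤ W := by
    rw [Submodule.span_le]
    rintro w ⟨a, ha, v, hv, h⟩
    obtain ⟨φ, hφ, haφ⟩ := hsub ha
    by_contra hw
    exact H φ hφ v hv w hw (haφ ▸ h)
  have hVT : V ≤ Submodule.span ℝ T := fun v hv => Submodule.subset_span
    ⟨ContinuousMap.id M, mem_connectedComponentIn id_mem_isometries, v, hv,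
      congrFun (tangentMap_id (I := 𝓡 n) (M := M)) _⟩
  have hinv := (hirr p).2 (Submodule.span ℝ T) ?_
  · rcases hinv with h | h
    · exact hV (le_bot_iff.1 (h ▸ hVT))
    · exact hW (top_le_iff.1 (h ▸ hTW))
  -- the span of the translates of `V` is invariant
  intro k hk v w hv hvw
  obtain ⟨φ, hφ, hkφ⟩ := hsub hk
  have hkp : k p = p := congrArg TotalSpace.proj hvw
  have hkd : MDifferentiable (𝓡 n) (𝓡 n) k := hkφ ▸ φ.mdifferentiable (by simp)
  let L : TangentSpace (𝓡 n) p →L[ℝ] TangentSpace (𝓡 n) p := mfderiv (𝓡 n) (𝓡 n) k p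
  have hL : ∀ u : TangentSpace (𝓡 n) p, tangentMap (𝓡 n) (𝓡 n) k ⟨p, u⟩ = ⟨p, L u⟩ := fun u =>
    congrArg (fun q => (⟨q, (L u : EuclideanSpace ℝ (Fin n))⟩ : TangentBundle (𝓡 n) M)) hkp
  have hw : w = L v := by
    rw [hL] at hvw
    exact (eq_of_heq (TotalSpace.mk.inj hvw).2).symm
  rw [hw]
  have hle : Submodule.span ℝ T ≤ (Submodule.span ℝ T).comap L.toLinearMap := by
    rw [Submodule.span_le]
    rintro u ⟨a, ha, v', hv', h⟩
    obtain ⟨ψ, hψ, haψ⟩ := hsub ha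
    have had : MDifferentiable (𝓡 n) (𝓡 n) a := haψ ▸ ψ.mdifferentiable (by simp)
    refine Submodule.subset_span ⟨k.comp a, comp_mem_identityComponent hk ha, v', hv', ?_⟩
    rw [ContinuousMap.coe_comp, tangentMap_comp_at _ (hkd _) (had _), h]
    exact hL u
  exact hle hv

end Irreducibility

/-! ### Immersions and curves in totally geodesic submanifolds -/

section Immersions

variable {k n : ℕ} {N : Type*} [TopologicalSpace N] [ChartedSpace (EuclideanSpace ℝ (Fin k)) N]
  [IsManifold (𝓡 k) ∞ N]
  {M : Type*} [TopologicalSpace M] [ChartedSpace (EuclideanSpace ℝ (Fin n)) M]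
  [IsManifold (𝓡 n) ∞ M]

/-- Every tangent vector at a point of a chart domain is a coordinate vector. -/
theorem exists_coordVec_eq {a q : N}
    (hq : q ∈ (extChartAt (𝓡 k) a).source) (v : TangentSpace (𝓡 k) q) :
    ∃ v', (⟨(extChartAt (𝓡 k) a).symm (extChartAt (𝓡 k) a q),
      coordVec a (extChartAt (𝓡 k) a q) v'⟩ : TangentBundle (𝓡 k) N) = ⟨q, v⟩ := by
  have h1 := tangentMap_comp_at (⟨q, v⟩ : TangentBundle (𝓡 k) N)
    ((contMDiffAt_extChartAt_symm ((extChartAt (𝓡 k) a).map_source hq)).mdifferentiableAt (by simp))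
    ((contMDiffAt_extChartAt_of_mem hq).mdifferentiableAt (by simp))
  refine ⟨mfderiv (𝓡 k) 𝓘(ℝ, EuclideanSpace ℝ (Fin k)) (extChartAt (𝓡 k) a) q v, h1.symm.trans ?_⟩
  have h2 : (extChartAt (𝓡 k) a).symm ∘ (extChartAt (𝓡 k) a) =ᶠ[𝓝 q] id := by
    filter_upwards [(isOpen_extChartAt_source a).mem_nhds hq] with z hz
    exact (extChartAt (𝓡 k) a).left_inv hz
  have h3 : (mfderiv (𝓡 k) (𝓡 k) ((extChartAt (𝓡 k) a).symm ∘ (extChartAt (𝓡 k) a)) q :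
      EuclideanSpace ℝ (Fin k) →L[ℝ] EuclideanSpace ℝ (Fin k)) v = v := by
    rw [h2.mfderiv_eq, mfderiv_id]
    rfl
  change (⟨_, (mfderiv (𝓡 k) (𝓡 k) ((extChartAt (𝓡 k) a).symm ∘ (extChartAt (𝓡 k) a)) q :
      EuclideanSpace ℝ (Fin k) →L[ℝ] EuclideanSpace ℝ (Fin k)) v⟩ : TangentBundle (𝓡 k) N) = _
  rw [h3]
  exact congrArg (fun r => (⟨r, v⟩ : TangentBundle (𝓡 k) N)) ((extChartAt (𝓡 k) a).left_inv hq)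

theorem fderiv_localRep_injective {f : N → M} (hf : ContMDiff (𝓡 k) (𝓡 n) ∞ f)
    (hinj : ∀ p, Function.Injective (mfderiv (𝓡 k) (𝓡 n) f p)) {a : N} {b : M}
    {y : EuclideanSpace ℝ (Fin k)} (hy : y ∈ (extChartAt (𝓡 k) a).target)
    (hb : f ((extChartAt (𝓡 k) a).symm y) ∈ (extChartAt (𝓡 n) b).source) :
    Function.Injective (fderiv ℝ (localRep k n f a b) y) := by
  rw [injective_iff_map_eq_zero]
  intro v hv
  have h := coordVec_fderiv_localRep hy (hf _) hb v
  rw [hv, map_zero] at h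
  have hzero : ∀ {x x' : M} {w : TangentSpace (𝓡 n) x'},
      (⟨x, 0⟩ : TangentBundle (𝓡 n) M) = ⟨x', w⟩ → w = 0 := by
    rintro x x' w ⟨⟩
    rfl
  have h1 := (injective_iff_map_eq_zero (mfderiv (𝓡 k) (𝓡 n) f _)).1 (hinj _) _ (hzero h)
  exact (injective_iff_map_eq_zero (coordVec a y)).1 (coordVec_injective hy) v h1

/-- An immersion has a smooth local left inverse, here composed with a chart of the source. -/
theorem exists_leftInverse_of_immersion {f : N → M} (hf : ContMDiff (𝓡 k) (𝓡 n) ∞ f)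
    (hinj : ∀ p, Function.Injective (mfderiv (𝓡 k) (𝓡 n) f p)) (p : N) :
    ∃ ρ : M → EuclideanSpace ℝ (Fin k),
      ContMDiffAt (𝓡 n) 𝓘(ℝ, EuclideanSpace ℝ (Fin k)) ∞ ρ (f p) ∧
      ∀ᶠ q in 𝓝 p, ρ (f q) = extChartAt (𝓡 k) p q := by
  set y := extChartAt (𝓡 k) p p with hy
  have hyt : y ∈ (extChartAt (𝓡 k) p).target := mem_extChartAt_target (I := 𝓡 k) p
  have hsy : (extChartAt (𝓡 k) p).symm y = p := extChartAt_to_inv (I := 𝓡 k) p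
  have hb : f ((extChartAt (𝓡 k) p).symm y) ∈ (extChartAt (𝓡 n) (f p)).source := by
    rw [hsy]; exact mem_extChartAt_source (I := 𝓡 n) (f p)
  let φ := localRep k n f p (f p)
  have hφ : ContDiffAt ℝ ∞ φ y := contDiffAt_localRep hyt (hf _) hb
  have hφy : φ y = extChartAt (𝓡 n) (f p) (f p) := by
    change extChartAt (𝓡 n) (f p) (f ((extChartAt (𝓡 k) p).symm y)) = _
    rw [hsy]
  obtain ⟨l, hl⟩ := LinearMap.exists_leftInverse_of_injective (fderiv ℝ φ y).toLinearMap
    (LinearMap.ker_eq_bot.2 (fderiv_localRep_injective hf hinj hyt hb))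
  let l' : EuclideanSpace ℝ (Fin n) →L[ℝ] EuclideanSpace ℝ (Fin k) :=
    LinearMap.toContinuousLinearMap l
  have hG : ContDiffAt ℝ ∞ (fun z => l' (φ z)) y := l'.contDiff.contDiffAt.comp y hφ
  have hG' : HasFDerivAt (fun z => l' (φ z))
      ((ContinuousLinearEquiv.refl ℝ (EuclideanSpace ℝ (Fin k)) :
        EuclideanSpace ℝ (Fin k) →L[ℝ] EuclideanSpace ℝ (Fin k))) y := by
    have h1 := l'.hasFDerivAt.comp y (hφ.differentiableAt (by simp)).hasFDerivAt
    have h2 : l' ∘L fderiv ℝ φ y = (ContinuousLinearEquiv.refl ℝ (EuclideanSpace ℝ (Fin k)) :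
        EuclideanSpace ℝ (Fin k) →L[ℝ] EuclideanSpace ℝ (Fin k)) := by
      ext1 v
      exact LinearMap.congr_fun hl v
    rwa [h2] at h1
  let θ := hG.localInverse hG' (by simp)
  have hθ : ContDiffAt ℝ ∞ θ (l' (φ y)) := hG.to_localInverse hG' (by simp)
  have hθl : ∀ᶠ z in 𝓝 y, θ (l' (φ z)) = z :=
    (hG.hasStrictFDerivAt' hG' (by simp)).eventually_left_inverse
  refine ⟨fun x => θ (l' (extChartAt (𝓡 n) (f p) x)), ?_, ?_⟩
  · rw [hφy] at hθ
    exact hθ.contMDiffAt.comp (f p) (l'.contDiff.contMDiff.contMDiffAt.comp (f p)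
      (contMDiffAt_extChartAt_of_mem (mem_extChartAt_source (I := 𝓡 n) (f p))))
  · filter_upwards [(continuousAt_extChartAt (I := 𝓡 k) p).eventually hθl,
      extChartAt_source_mem_nhds (I := 𝓡 k) p] with q hq hqs
    have : φ (extChartAt (𝓡 k) p q) = extChartAt (𝓡 n) (f p) (f q) := by
      change extChartAt (𝓡 n) (f p) (f ((extChartAt (𝓡 k) p).symm (extChartAt (𝓡 k) p q))) = _
      rw [(extChartAt (𝓡 k) p).left_inv hqs]
    rwa [this] at hq

/-- A continuous lift of a `C²` curve through an immersion is `C²`. -/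
theorem contMDiffAt_of_immersion_comp {f : N → M} (hf : ContMDiff (𝓡 k) (𝓡 n) ∞ f)
    (hinj : ∀ p, Function.Injective (mfderiv (𝓡 k) (𝓡 n) f p)) {c : ℝ → N} {t : ℝ}
    (hc : ContinuousAt c t) (hfc : ContMDiffAt 𝓘(ℝ, ℝ) (𝓡 n) 2 (fun s => f (c s)) t) :
    ContMDiffAt 𝓘(ℝ, ℝ) (𝓡 k) 2 c t := by
  obtain ⟨ρ, hρ, hρf⟩ := exists_leftInverse_of_immersion hf hinj (c t)
  have h1 : (fun s => (extChartAt (𝓡 k) (c t)).symm (ρ (f (c s)))) =ᶠ[𝓝 t] c := by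
    filter_upwards [hc.eventually hρf,
      hc.eventually (extChartAt_source_mem_nhds (I := 𝓡 k) (c t))] with s hs hs'
    rw [hs, (extChartAt (𝓡 k) (c t)).left_inv hs']
  have h2 : ContMDiffAt 𝓘(ℝ, ℝ) 𝓘(ℝ, EuclideanSpace ℝ (Fin k)) 2 (fun s => ρ (f (c s))) t :=
    (hρ.of_le two_le_infty).comp t hfc
  have h3 : ρ (f (c t)) ∈ (extChartAt (𝓡 k) (c t)).target := by
    rw [hρf.self_of_nhds]; exact mem_extChartAt_target (I := 𝓡 k) (c t)
  exact (((contMDiffAt_extChartAt_symm h3).of_le two_le_infty).comp t h2).congr_of_eventuallyEq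
    h1.symm

end Immersions

section TotallyGeodesicCurves

variable {k m n : ℕ} {N : Type*} [TopologicalSpace N] [ChartedSpace (EuclideanSpace ℝ (Fin k)) N]
  [IsManifold (𝓡 k) ∞ N]
  {S : Type*} [TopologicalSpace S] [ChartedSpace (EuclideanSpace ℝ (Fin m)) S]
  [IsManifold (𝓡 m) ∞ S]
  {M : Type*} [TopologicalSpace M] [ChartedSpace (EuclideanSpace ℝ (Fin n)) M]
  [IsManifold (𝓡 n) ∞ M] [RiemannianBundle (fun x : M => TangentSpace (𝓡 n) x)]

/-- The short geodesics tangent to a totally geodesic submanifold are `C²` curves in it. -/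
theorem IsTotallyGeodesicSubmanifold.exists_curve {f : N → M}
    (hf : IsTotallyGeodesicSubmanifold (m := k) (n := n) f) (q : N) (v : TangentSpace (𝓡 k) q) :
    ∃ (ε : ℝ) (c : ℝ → N), 0 < ε ∧ ContMDiffOn 𝓘(ℝ, ℝ) (𝓡 k) 2 c (Ioo (-ε) ε) ∧
      IsGeodesicOn (n := n) (fun t => f (c t)) (Ioo (-ε) ε) ∧
      tangentMap 𝓘(ℝ, ℝ) (𝓡 k) c ⟨0, (1 : ℝ)⟩ = ⟨q, v⟩ := by
  obtain ⟨ε, c, hε, hc, hgeo, hvel, rfl⟩ := hf.geodesic q v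
  have hc2 : ContMDiffOn 𝓘(ℝ, ℝ) (𝓡 k) 2 c (Ioo (-ε) ε) := fun t ht =>
    (contMDiffAt_of_immersion_comp hf.contMDiff hf.immersion
      (hc.continuousAt (isOpen_Ioo.mem_nhds ht))
      (hgeo.1.contMDiffAt (isOpen_Ioo.mem_nhds ht))).contMDiffWithinAt
  refine ⟨ε, c, hε, hc2, hgeo, ?_⟩
  have h0 : (0 : ℝ) ∈ Ioo (-ε) ε := ⟨by linarith, hε⟩
  have h1 := tangentMap_comp_at (⟨0, (1 : ℝ)⟩ : TangentBundle 𝓘(ℝ, ℝ) ℝ)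
    (hf.contMDiff.mdifferentiable (by simp) (c 0))
    ((hc2.contMDiffAt (isOpen_Ioo.mem_nhds h0)).mdifferentiableAt (by simp))
  have h2 := h1.symm.trans hvel
  have h3 := hf.immersion (c 0) (eq_of_heq (TotalSpace.mk.inj h2).2)
  exact congrArg (fun v => (⟨c 0, v⟩ : TangentBundle (𝓡 k) N)) h3

/-- Two totally geodesic submanifolds with a common tangent vector have a common short geodesic in
its direction. -/
theorem exists_common_curve [T2Space M]
    [IsContMDiffRiemannianBundle (𝓡 n) ∞ (EuclideanSpace ℝ (Fin n))
      (fun x : M => TangentSpace (𝓡 n) x)] {f : N → M} {h : S → M}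
    (hf : IsTotallyGeodesicSubmanifold (m := k) (n := n) f)
    (hh : IsTotallyGeodesicSubmanifold (m := m) (n := n) h)
    {q : N} {s : S} {v : TangentSpace (𝓡 k) q} {w : TangentSpace (𝓡 m) s}
    (hvw : tangentMap (𝓡 k) (𝓡 n) f ⟨q, v⟩ = tangentMap (𝓡 m) (𝓡 n) h ⟨s, w⟩) :
    ∃ (ε : ℝ) (c₁ : ℝ → N) (c₂ : ℝ → S), 0 < ε ∧
      ContMDiffOn 𝓘(ℝ, ℝ) (𝓡 k) 2 c₁ (Ioo (-ε) ε) ∧ ContMDiffOn 𝓘(ℝ, ℝ) (𝓡 m) 2 c₂ (Ioo (-ε) ε) ∧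
      IsGeodesicOn (n := n) (fun t => f (c₁ t)) (Ioo (-ε) ε) ∧
      (∀ t ∈ Ioo (-ε) ε, f (c₁ t) = h (c₂ t)) ∧
      tangentMap 𝓘(ℝ, ℝ) (𝓡 k) c₁ ⟨0, (1 : ℝ)⟩ = ⟨q, v⟩ ∧
      tangentMap 𝓘(ℝ, ℝ) (𝓡 m) c₂ ⟨0, (1 : ℝ)⟩ = ⟨s, w⟩ := by
  obtain ⟨ε₁, c₁, hε₁, hc₁, hg₁, hv₁⟩ := hf.exists_curve q v
  obtain ⟨ε₂, c₂, hε₂, hc₂, hg₂, hv₂⟩ := hh.exists_curve s w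
  have hs₁ : Ioo (-(min ε₁ ε₂)) (min ε₁ ε₂) ⊆ Ioo (-ε₁) ε₁ :=
    Ioo_subset_Ioo (neg_le_neg (min_le_left _ _)) (min_le_left _ _)
  have hs₂ : Ioo (-(min ε₁ ε₂)) (min ε₁ ε₂) ⊆ Ioo (-ε₂) ε₂ :=
    Ioo_subset_Ioo (neg_le_neg (min_le_right _ _)) (min_le_right _ _)
  have hε : 0 < min ε₁ ε₂ := lt_min hε₁ hε₂
  have h0 : (0 : ℝ) ∈ Ioo (-(min ε₁ ε₂)) (min ε₁ ε₂) := ⟨by linarith, hε⟩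
  refine ⟨min ε₁ ε₂, c₁, c₂, hε, hc₁.mono hs₁, hc₂.mono hs₂, hg₁.mono hs₁, ?_, hv₁, hv₂⟩
  refine (hg₁.mono hs₁).eqOn isOpen_Ioo isPreconnected_Ioo (hg₂.mono hs₂) h0 ?_
  have e1 := tangentMap_comp_at (⟨0, (1 : ℝ)⟩ : TangentBundle 𝓘(ℝ, ℝ) ℝ)
    (hf.contMDiff.mdifferentiable (by simp) (c₁ 0))
    ((hc₁.contMDiffAt (isOpen_Ioo.mem_nhds (hs₁ h0))).mdifferentiableAt (by simp))
  have e2 := tangentMap_comp_at (⟨0, (1 : ℝ)⟩ : TangentBundle 𝓘(ℝ, ℝ) ℝ)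
    (hh.contMDiff.mdifferentiable (by simp) (c₂ 0))
    ((hc₂.contMDiffAt (isOpen_Ioo.mem_nhds (hs₂ h0))).mdifferentiableAt (by simp))
  rw [hv₁, hvw] at e1
  rw [hv₂] at e2
  exact e1.trans e2.symm

omit [IsManifold (𝓡 m) ∞ S] in
theorem IsTotallyGeodesicSubmanifold.map_isometry
    [IsContMDiffRiemannianBundle (𝓡 n) ∞ (EuclideanSpace ℝ (Fin n))
      (fun x : M => TangentSpace (𝓡 n) x)] {h : S → M}
    (hh : IsTotallyGeodesicSubmanifold (m := m) (n := n) h) {φ : M ≃ₘ^∞⟮𝓡 n, 𝓡 n⟯ M}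
    (hφ : PreservesMetric (k := n) (n := n) (φ : M → M)) :
    IsTotallyGeodesicSubmanifold (m := m) (n := n) (φ ∘ h) where
  injective := φ.injective.comp hh.injective
  contMDiff := φ.contMDiff.comp hh.contMDiff
  immersion p := by
    rw [mfderiv_comp p (φ.mdifferentiable (by simp) _) (hh.contMDiff.mdifferentiable (by simp) _)]
    refine Function.Injective.comp (g := mfderiv (𝓡 n) (𝓡 n) φ (h p)) ?_ (hh.immersion p)
    rw [injective_iff_map_eq_zero]
    intro v hv
    have := hφ (h p) v v
    rw [hv, inner_zero_left] at this
    exact inner_self_eq_zero.1 this.symm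
  geodesic p v := by
    obtain ⟨ε, c, hε, hc, hgeo, hvel, hc0⟩ := hh.geodesic p v
    refine ⟨ε, c, hε, hc, hgeo.map_isometry hφ isOpen_Ioo, ?_, hc0⟩
    have h0 : (0 : ℝ) ∈ Ioo (-ε) ε := ⟨by linarith, hε⟩
    have e1 := tangentMap_comp_at (g := φ) (f := fun t => h (c t))
      (⟨0, (1 : ℝ)⟩ : TangentBundle 𝓘(ℝ, ℝ) ℝ) (φ.mdifferentiable (by simp) _)
      ((hgeo.1.contMDiffAt (isOpen_Ioo.mem_nhds h0)).mdifferentiableAt (by simp))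
    have e2 := tangentMap_comp_at (g := φ) (f := h) (⟨p, v⟩ : TangentBundle (𝓡 m) S)
      (φ.mdifferentiable (by simp) _) (hh.contMDiff.mdifferentiable (by simp) _)
    rw [hvel] at e1
    exact e1.trans e2.symm

end TotallyGeodesicCurves

/-! ### Intersections of totally geodesic submanifolds -/

section Intersection

variable {k m n : ℕ} {N : Type*} [TopologicalSpace N] [ChartedSpace (EuclideanSpace ℝ (Fin k)) N]
  [IsManifold (𝓡 k) ∞ N]
  {S : Type*} [TopologicalSpace S] [ChartedSpace (EuclideanSpace ℝ (Fin m)) S]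
  [IsManifold (𝓡 m) ∞ S]
  {M : Type*} [TopologicalSpace M] [ChartedSpace (EuclideanSpace ℝ (Fin n)) M]
  [IsManifold (𝓡 n) ∞ M]

omit [IsManifold (𝓡 n) ∞ M] [IsManifold (𝓡 k) ∞ N] in
theorem isOpen_localRep_domain {f : N → M} (hf : Continuous f) (a : N) (b : M) :
    IsOpen {y | y ∈ (extChartAt (𝓡 k) a).target ∧
      f ((extChartAt (𝓡 k) a).symm y) ∈ (extChartAt (𝓡 n) b).source} :=
  (hf.comp_continuousOn (continuousOn_extChartAt_symm a)).isOpen_inter_preimage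
    (isOpen_extChartAt_target a) (isOpen_extChartAt_source b)

/-- The velocity in a chart of a curve whose velocity is given by the coordinate vector `v`. -/
theorem hasDerivAt_extChartAt_comp {a : S} {y v : EuclideanSpace ℝ (Fin m)}
    (hy : y ∈ (extChartAt (𝓡 m) a).target) {c : ℝ → S}
    (hc : ContMDiffAt 𝓘(ℝ, ℝ) (𝓡 m) 2 c 0)
    (hv : tangentMap 𝓘(ℝ, ℝ) (𝓡 m) c ⟨0, (1 : ℝ)⟩ =
      ⟨(extChartAt (𝓡 m) a).symm y, coordVec a y v⟩) :
    extChartAt (𝓡 m) a (c 0) = y ∧ HasDerivAt (fun t => extChartAt (𝓡 m) a (c t)) v 0 := by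
  have hp : c 0 = (extChartAt (𝓡 m) a).symm y := congrArg TotalSpace.proj hv
  have hs : c 0 ∈ (extChartAt (𝓡 m) a).source := hp ▸ (extChartAt (𝓡 m) a).map_target hy
  refine ⟨by rw [hp, (extChartAt (𝓡 m) a).right_inv hy], ?_⟩
  have hd : DifferentiableAt ℝ (fun t => extChartAt (𝓡 m) a (c t)) 0 := by
    rw [← mdifferentiableAt_iff_differentiableAt]
    exact ((contMDiffAt_extChartAt_of_mem hs).mdifferentiableAt (by simp)).comp 0
      (hc.mdifferentiableAt (by simp))
  have h1 := deriv_extChartAt_comp (hc.mdifferentiableAt (by simp)) hs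
  rw [hv] at h1
  have h2 : deriv (fun t => extChartAt (𝓡 m) a (c t)) 0 = v :=
    (eq_of_heq (TotalSpace.mk.inj h1).2).trans (mfderiv_extChartAt_coordVec hy v)
  exact h2 ▸ hd.hasDerivAt

/-- Two totally geodesic submanifolds that meet, the first one not tangent to the second one at
the common point, contain a common totally geodesic submanifold of the expected dimension or more,
which is a proper one in the first submanifold. -/
theorem exists_totallyGeodesic_inter [T2Space M]
    [RiemannianBundle (fun x : M => TangentSpace (𝓡 n) x)]
    [IsContMDiffRiemannianBundle (𝓡 n) ∞ (EuclideanSpace ℝ (Fin n))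
      (fun x : M => TangentSpace (𝓡 n) x)]
    [RiemannianBundle (fun x : N => TangentSpace (𝓡 k) x)]
    {f : N → M} {h : S → M} (hf : IsTotallyGeodesicSubmanifold (m := k) (n := n) f)
    (hfm : PreservesMetric (k := k) (n := n) f)
    (hh : IsTotallyGeodesicSubmanifold (m := m) (n := n) h) {q₀ : N} {s₀ : S}
    (h₀ : f q₀ = h s₀) {v₀ : TangentSpace (𝓡 k) q₀}
    (hv₀ : ∀ w : TangentSpace (𝓡 m) s₀,
      tangentMap (𝓡 k) (𝓡 n) f ⟨q₀, v₀⟩ ≠ tangentMap (𝓡 m) (𝓡 n) h ⟨s₀, w⟩) :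
    ∃ D : ℕ, D < k ∧ k + m ≤ D + n ∧ ∃ j : EuclideanSpace ℝ (Fin D) → N,
      IsTotallyGeodesicSubmanifold (m := D) (n := k) j := by
  set b := f q₀ with hb
  let F := localRep k n f q₀ b
  let H := localRep m n h s₀ b
  let Ω₁ := {y | y ∈ (extChartAt (𝓡 k) q₀).target ∧
      f ((extChartAt (𝓡 k) q₀).symm y) ∈ (extChartAt (𝓡 n) b).source}
  let Ω₂ := {y | y ∈ (extChartAt (𝓡 m) s₀).target ∧
      h ((extChartAt (𝓡 m) s₀).symm y) ∈ (extChartAt (𝓡 n) b).source}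
  have hΩ : IsOpen (Ω₁ ×ˢ Ω₂) := (isOpen_localRep_domain hf.contMDiff.continuous q₀ b).prod
    (isOpen_localRep_domain hh.contMDiff.continuous s₀ b)
  have hF : ∀ y ∈ Ω₁, ContDiffAt ℝ ∞ F y := fun y hy =>
    contDiffAt_localRep hy.1 (hf.contMDiff _) hy.2
  have hH : ∀ y ∈ Ω₂, ContDiffAt ℝ ∞ H y := fun y hy =>
    contDiffAt_localRep hy.1 (hh.contMDiff _) hy.2
  let Φ : EuclideanSpace ℝ (Fin k) × EuclideanSpace ℝ (Fin m) → EuclideanSpace ℝ (Fin n) :=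
    fun z => F z.1 - H z.2
  have hΦ : ∀ z ∈ Ω₁ ×ˢ Ω₂, ContDiffAt ℝ ∞ Φ z := fun z hz =>
    ((hF z.1 hz.1).comp z contDiffAt_fst).sub ((hH z.2 hz.2).comp z contDiffAt_snd)
  have hdΦ : ∀ z ∈ Ω₁ ×ˢ Ω₂, ∀ e, fderiv ℝ Φ z e = fderiv ℝ F z.1 e.1 - fderiv ℝ H z.2 e.2 := by
    intro z hz e
    have h1 := ((hF z.1 hz.1).differentiableAt (by simp)).hasFDerivAt.comp z
      (hasFDerivAt_fst (𝕜 := ℝ) (p := z))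
    have h2 := ((hH z.2 hz.2).differentiableAt (by simp)).hasFDerivAt.comp z
      (hasFDerivAt_snd (𝕜 := ℝ) (p := z))
    exact congrArg (fun l : _ →L[ℝ] EuclideanSpace ℝ (Fin n) => l e) (h1.sub h2).fderiv
  have hHinj : ∀ y ∈ Ω₂, Function.Injective (fderiv ℝ H y) := fun y hy =>
    fderiv_localRep_injective hh.contMDiff hh.immersion hy.1 hy.2
  -- zeros of `Φ` are intersection points, and elements of `ker dΦ` are common tangent vectors
  have hpoint : ∀ z ∈ Ω₁ ×ˢ Ω₂, Φ z = 0 →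
      f ((extChartAt (𝓡 k) q₀).symm z.1) = h ((extChartAt (𝓡 m) s₀).symm z.2) :=
    fun z hz hz0 => (extChartAt (𝓡 n) b).injOn hz.1.2 hz.2.2 (sub_eq_zero.1 hz0)
  have hvec : ∀ z ∈ Ω₁ ×ˢ Ω₂, Φ z = 0 → ∀ e, fderiv ℝ Φ z e = 0 →
      tangentMap (𝓡 k) (𝓡 n) f ⟨(extChartAt (𝓡 k) q₀).symm z.1, coordVec q₀ z.1 e.1⟩ =
      tangentMap (𝓡 m) (𝓡 n) h ⟨(extChartAt (𝓡 m) s₀).symm z.2, coordVec s₀ z.2 e.2⟩ := by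
    intro z hz hz0 e he
    rw [hdΦ z hz, sub_eq_zero] at he
    have h1 := coordVec_fderiv_localRep hz.1.1 (hf.contMDiff _) hz.1.2 e.1
    have h2 := coordVec_fderiv_localRep hz.2.1 (hh.contMDiff _) hz.2.2 e.2
    refine h1.symm.trans (Eq.trans ?_ h2)
    change (⟨(extChartAt (𝓡 n) b).symm (F z.1), coordVec b (F z.1) (fderiv ℝ F z.1 e.1)⟩ :
      TangentBundle (𝓡 n) M) = ⟨(extChartAt (𝓡 n) b).symm (H z.2),
        coordVec b (H z.2) (fderiv ℝ H z.2 e.2)⟩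
    rw [he, sub_eq_zero.1 hz0]
  -- the base point
  set x₀ := extChartAt (𝓡 k) q₀ q₀ with hx₀
  set y₀ := extChartAt (𝓡 m) s₀ s₀ with hy₀
  have hx₀s : (extChartAt (𝓡 k) q₀).symm x₀ = q₀ := extChartAt_to_inv (I := 𝓡 k) q₀
  have hy₀s : (extChartAt (𝓡 m) s₀).symm y₀ = s₀ := extChartAt_to_inv (I := 𝓡 m) s₀
  have hz₀ : (x₀, y₀) ∈ Ω₁ ×ˢ Ω₂ := by
    refine ⟨⟨mem_extChartAt_target (I := 𝓡 k) q₀, ?_⟩, ⟨mem_extChartAt_target (I := 𝓡 m) s₀, ?_⟩⟩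
    · change f ((extChartAt (𝓡 k) q₀).symm x₀) ∈ _
      rw [hx₀s]; exact mem_extChartAt_source (I := 𝓡 n) b
    · change h ((extChartAt (𝓡 m) s₀).symm y₀) ∈ _
      rw [hy₀s, ← h₀]; exact mem_extChartAt_source (I := 𝓡 n) b
  have hΦ₀ : Φ (x₀, y₀) = 0 := by
    change extChartAt (𝓡 n) b (f ((extChartAt (𝓡 k) q₀).symm x₀)) -
      extChartAt (𝓡 n) b (h ((extChartAt (𝓡 m) s₀).symm y₀)) = 0
    rw [hx₀s, hy₀s, ← h₀, sub_self]
  -- the kernel injects into the tangent space of `N`, and misses the non-tangent vector `v₀`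
  have hker : Module.finrank ℝ (fderiv ℝ Φ (x₀, y₀)).ker < k := by
    let r : (fderiv ℝ Φ (x₀, y₀)).ker →ₗ[ℝ] EuclideanSpace ℝ (Fin k) :=
      LinearMap.fst ℝ _ _ ∘ₗ (fderiv ℝ Φ (x₀, y₀)).ker.subtype
    have hr : Function.Injective r := by
      rw [injective_iff_map_eq_zero]
      rintro ⟨⟨e₁, e₂⟩, he⟩ h1
      change e₁ = 0 at h1
      have he' : fderiv ℝ Φ (x₀, y₀) (e₁, e₂) = 0 := he
      rw [hdΦ _ hz₀] at he'
      simp only [h1, map_zero, zero_sub, neg_eq_zero] at he'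
      have h2 := (injective_iff_map_eq_zero (fderiv ℝ H y₀)).1 (hHinj y₀ hz₀.2) e₂ he'
      simp [h1, h2]
    have hnot : LinearMap.range r ≠ ⊤ := by
      intro htop
      obtain ⟨v', hv'⟩ := exists_coordVec_eq (mem_extChartAt_source (I := 𝓡 k) q₀) v₀
      obtain ⟨⟨⟨e₁, e₂⟩, he⟩, h1⟩ := LinearMap.range_eq_top.1 htop v'
      change e₁ = v' at h1
      subst h1
      have h2 := hvec _ hz₀ hΦ₀ _ he
      rw [hv'] at h2
      refine hv₀ (coordVec s₀ y₀ e₂ : EuclideanSpace ℝ (Fin m)) (h2.trans ?_)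
      exact congrArg (fun s => tangentMap (𝓡 m) (𝓡 n) h
        (⟨s, (coordVec s₀ y₀ e₂ : EuclideanSpace ℝ (Fin m))⟩ : TangentBundle (𝓡 m) S)) hy₀s
    have h1 := Submodule.finrank_lt hnot
    rw [LinearMap.finrank_range_of_inj hr, finrank_euclideanSpace_fin] at h1
    exact h1
  -- every element of the kernel is the velocity of a curve of zeros, made of a geodesic of `N`
  have htan : ∀ z ∈ Ω₁ ×ˢ Ω₂, Φ z = 0 → ∀ e, fderiv ℝ Φ z e = 0 →
      ∃ (ε : ℝ) (c₁ : ℝ → N) (c₂ : ℝ → S), 0 < ε ∧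
        IsGeodesicOn (n := k) c₁ (Ioo (-ε) ε) ∧
        (∀ t ∈ Ioo (-ε) ε, ContinuousAt c₁ t ∧ ContinuousAt c₂ t ∧
          c₁ t ∈ (extChartAt (𝓡 k) q₀).source ∧ c₂ t ∈ (extChartAt (𝓡 m) s₀).source ∧
          Φ (extChartAt (𝓡 k) q₀ (c₁ t), extChartAt (𝓡 m) s₀ (c₂ t)) = 0) ∧
        tangentMap 𝓘(ℝ, ℝ) (𝓡 k) c₁ ⟨0, (1 : ℝ)⟩ =
          ⟨(extChartAt (𝓡 k) q₀).symm z.1, coordVec q₀ z.1 e.1⟩ ∧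
        (extChartAt (𝓡 k) q₀ (c₁ 0), extChartAt (𝓡 m) s₀ (c₂ 0)) = z ∧
        HasDerivAt (fun t => (extChartAt (𝓡 k) q₀ (c₁ t), extChartAt (𝓡 m) s₀ (c₂ t))) e 0 := by
    intro z hz hz0 e he
    obtain ⟨ε, c₁, c₂, hε, hc₁, hc₂, hgeo, heq, hv₁, hv₂⟩ :=
      exists_common_curve hf hh (hvec z hz hz0 e he)
    have h0 : (0 : ℝ) ∈ Ioo (-ε) ε := ⟨by linarith, hε⟩
    have hc₁' := fun t (ht : t ∈ Ioo (-ε) ε) => hc₁.contMDiffAt (isOpen_Ioo.mem_nhds ht)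
    have hc₂' := fun t (ht : t ∈ Ioo (-ε) ε) => hc₂.contMDiffAt (isOpen_Ioo.mem_nhds ht)
    obtain ⟨hz1, hd₁⟩ := hasDerivAt_extChartAt_comp hz.1.1 (hc₁' 0 h0) hv₁
    obtain ⟨hz2, hd₂⟩ := hasDerivAt_extChartAt_comp hz.2.1 (hc₂' 0 h0) hv₂
    have hp₁ : c₁ 0 = (extChartAt (𝓡 k) q₀).symm z.1 := congrArg TotalSpace.proj hv₁
    have hp₂ : c₂ 0 = (extChartAt (𝓡 m) s₀).symm z.2 := congrArg TotalSpace.proj hv₂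
    have hs₁ : ∀ᶠ t in 𝓝 (0 : ℝ), c₁ t ∈ (extChartAt (𝓡 k) q₀).source :=
      (hc₁' 0 h0).continuousAt.eventually ((isOpen_extChartAt_source q₀).mem_nhds
        (hp₁ ▸ (extChartAt (𝓡 k) q₀).map_target hz.1.1))
    have hs₂ : ∀ᶠ t in 𝓝 (0 : ℝ), c₂ t ∈ (extChartAt (𝓡 m) s₀).source :=
      (hc₂' 0 h0).continuousAt.eventually ((isOpen_extChartAt_source s₀).mem_nhds
        (hp₂ ▸ (extChartAt (𝓡 m) s₀).map_target hz.2.1))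
    obtain ⟨δ, hδ, hball⟩ := Metric.nhds_basis_ball.mem_iff.1
      (hs₁.and (hs₂.and (isOpen_Ioo.mem_nhds h0)))
    have hsub : ∀ t ∈ Ioo (-δ) δ, c₁ t ∈ (extChartAt (𝓡 k) q₀).source ∧
        c₂ t ∈ (extChartAt (𝓡 m) s₀).source ∧ t ∈ Ioo (-ε) ε := fun t ht =>
      hball (by rw [Real.ball_eq_Ioo]; simpa using ht)
    refine ⟨δ, c₁, c₂, hδ, ?_, fun t ht => ?_, hv₁, Prod.ext hz1 hz2, hd₁.prodMk hd₂⟩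
    · exact (IsGeodesicOn.of_comp hf.contMDiff hfm isOpen_Ioo hc₁ hgeo).mono
        fun t ht => (hsub t ht).2.2
    · obtain ⟨h1, h2, h3⟩ := hsub t ht
      refine ⟨(hc₁' t h3).continuousAt, (hc₂' t h3).continuousAt, h1, h2, ?_⟩
      change extChartAt (𝓡 n) b (f ((extChartAt (𝓡 k) q₀).symm (extChartAt (𝓡 k) q₀ (c₁ t)))) -
        extChartAt (𝓡 n) b (h ((extChartAt (𝓡 m) s₀).symm (extChartAt (𝓡 m) s₀ (c₂ t)))) = 0
      rw [(extChartAt (𝓡 k) q₀).left_inv h1, (extChartAt (𝓡 m) s₀).left_inv h2, heq t h3, sub_self]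
  obtain ⟨D, hD, hdim, ψ, κ, O, hψ, hO, hκ, hψO, hκψ⟩ := exists_zeroSet_param hΩ
    (fun z hz => (hΦ z hz).contDiffWithinAt) hz₀ hΦ₀ (fun z hz hz0 e he => by
      obtain ⟨ε, c₁, c₂, hε, -, hc, -, h1, h2⟩ := htan z hz hz0 e he
      refine ⟨_, h1, h2, ?_⟩
      filter_upwards [isOpen_Ioo.mem_nhds (show (0 : ℝ) ∈ Ioo (-ε) ε from ⟨by linarith, hε⟩)]
        with t ht
      exact (hc t ht).2.2.2.2)
  rw [Module.finrank_prod, finrank_euclideanSpace_fin, finrank_euclideanSpace_fin,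
    finrank_euclideanSpace_fin] at hdim
  -- the submanifold, seen in `N`
  let j : EuclideanSpace ℝ (Fin D) → N := fun u => (extChartAt (𝓡 k) q₀).symm (ψ u).1
  have hψd : ∀ u, DifferentiableAt ℝ ψ u := fun u => hψ.contDiffAt.differentiableAt (by simp)
  have hψker : ∀ u e, fderiv ℝ Φ (ψ u) (fderiv ℝ ψ u e) = 0 := by
    intro u e
    have h1 := ((hΦ _ (hψO u).2.1).differentiableAt (by simp)).hasFDerivAt.comp u
      (hψd u).hasFDerivAt
    have h2 : Φ ∘ ψ = fun _ => 0 := funext fun u => (hψO u).2.2.1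
    rw [h2] at h1
    exact congrArg (fun l : _ →L[ℝ] EuclideanSpace ℝ (Fin n) => l e)
      (h1.unique (hasFDerivAt_const _ _))
  have hψinj : ∀ u, Function.Injective (fderiv ℝ ψ u) := by
    intro u
    have h1 := (hκ.differentiableAt (hO.mem_nhds (hψO u).1)).hasFDerivAt.comp u
      (hψd u).hasFDerivAt
    have h2 : κ ∘ ψ = id := funext fun u => (hψO u).2.2.2
    rw [h2] at h1
    have h3 := h1.unique (hasFDerivAt_id u)
    exact Function.LeftInverse.injective (g := fderiv ℝ κ (ψ u)) fun e =>
      congrArg (fun l : _ →L[ℝ] EuclideanSpace ℝ (Fin D) => l e) h3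
  have hψ₁ : ∀ u, ContMDiffAt 𝓘(ℝ, EuclideanSpace ℝ (Fin D)) 𝓘(ℝ, EuclideanSpace ℝ (Fin k)) ∞
      (fun u => (ψ u).1) u := fun u => (hψ.fst.contDiffAt).contMDiffAt
  have hjmd : ∀ u, ContMDiffAt (𝓡 D) (𝓡 k) ∞ j u := fun u =>
    (contMDiffAt_extChartAt_symm (hψO u).2.1.1.1).comp u (hψ₁ u)
  have hjv : ∀ u e, tangentMap (𝓡 D) (𝓡 k) j ⟨u, e⟩ =
      ⟨(extChartAt (𝓡 k) q₀).symm (ψ u).1, coordVec q₀ (ψ u).1 (fderiv ℝ ψ u e).1⟩ := by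
    intro u e
    have h1 := tangentMap_comp_at (⟨u, e⟩ : TangentBundle (𝓡 D) (EuclideanSpace ℝ (Fin D)))
      ((contMDiffAt_extChartAt_symm (hψO u).2.1.1.1).mdifferentiableAt (by simp))
      ((hψ₁ u).mdifferentiableAt (by simp))
    refine h1.trans ?_
    have h2 : (mfderiv (𝓡 D) (𝓡 k) (fun u => (ψ u).1) u : EuclideanSpace ℝ (Fin D) →
        EuclideanSpace ℝ (Fin k)) e = (fderiv ℝ ψ u e).1 := by
      rw [mfderiv_eq_fderiv, (hψd u).hasFDerivAt.fst.fderiv]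
      rfl
    exact congrArg (fun v => (⟨(extChartAt (𝓡 k) q₀).symm (ψ u).1, coordVec q₀ (ψ u).1 v⟩ :
      TangentBundle (𝓡 k) N)) h2
  refine ⟨D, hD.trans_lt hker, hdim, j, ?_, hjmd, ?_, ?_⟩
  · intro u u' huu
    have h1 : (ψ u).1 = (ψ u').1 :=
      (extChartAt (𝓡 k) q₀).symm.injOn (hψO u).2.1.1.1 (hψO u').2.1.1.1 huu
    have h2 := hpoint _ (hψO u).2.1 (hψO u).2.2.1
    rw [h1, hpoint _ (hψO u').2.1 (hψO u').2.2.1] at h2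
    have h3 : (ψ u).2 = (ψ u').2 :=
      (extChartAt (𝓡 m) s₀).symm.injOn (hψO u).2.1.2.1 (hψO u').2.1.2.1 (hh.injective h2).symm
    rw [← (hψO u).2.2.2, ← (hψO u').2.2.2, Prod.ext h1 h3]
  · intro u
    rw [injective_iff_map_eq_zero]
    intro e he
    have h1 : coordVec q₀ (ψ u).1 (fderiv ℝ ψ u e).1 = 0 :=
      (eq_of_heq (TotalSpace.mk.inj (hjv u e)).2).symm.trans he
    have h2 := (injective_iff_map_eq_zero (coordVec q₀ (ψ u).1)).1
      (coordVec_injective (hψO u).2.1.1.1) _ h1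
    have h3 := hψker u e
    rw [hdΦ _ (hψO u).2.1, h2, map_zero, zero_sub, neg_eq_zero] at h3
    have h4 := (injective_iff_map_eq_zero (fderiv ℝ H (ψ u).2)).1 (hHinj _ (hψO u).2.1.2) _ h3
    exact (injective_iff_map_eq_zero (fderiv ℝ ψ u)).1 (hψinj u) e (Prod.ext h2 h4)
  · intro u e
    obtain ⟨ε, c₁, c₂, hε, hgeo, hc, hv₁, hz, hder⟩ :=
      htan _ (hψO u).2.1 (hψO u).2.2.1 _ (hψker u e)
    let ζ : ℝ → EuclideanSpace ℝ (Fin k) × EuclideanSpace ℝ (Fin m) :=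
      fun t => (extChartAt (𝓡 k) q₀ (c₁ t), extChartAt (𝓡 m) s₀ (c₂ t))
    have h0 : (0 : ℝ) ∈ Ioo (-ε) ε := ⟨by linarith, hε⟩
    have hζ0 : ζ 0 = ψ u := hz
    have hζ0O : ζ 0 ∈ O := by rw [hζ0]; exact (hψO u).1
    have hζO : ∀ᶠ t in 𝓝 (0 : ℝ), ζ t ∈ O :=
      hder.continuousAt.eventually (p := (· ∈ O)) (hO.mem_nhds hζ0O)
    obtain ⟨δ, hδ, hball⟩ := Metric.nhds_basis_ball.mem_iff.1
      (hζO.and (isOpen_Ioo.mem_nhds h0))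
    have hsub : ∀ t ∈ Ioo (-δ) δ, ζ t ∈ O ∧ t ∈ Ioo (-ε) ε := fun t ht =>
      hball (by rw [Real.ball_eq_Ioo]; simpa using ht)
    have hjc : ∀ t ∈ Ioo (-δ) δ, j (κ (ζ t)) = c₁ t := by
      intro t ht
      obtain ⟨h1, h2⟩ := hsub t ht
      change (extChartAt (𝓡 k) q₀).symm (ψ (κ (ζ t))).1 = c₁ t
      rw [hκψ _ h1 (hc t h2).2.2.2.2]
      exact (extChartAt (𝓡 k) q₀).left_inv (hc t h2).2.2.1
    have h0δ : (0 : ℝ) ∈ Ioo (-δ) δ := ⟨by linarith, hδ⟩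
    have hκ0 : κ (ζ 0) = u := by rw [hζ0, (hψO u).2.2.2]
    refine ⟨δ, fun t => κ (ζ t), hδ, ?_, ?_, ?_, hκ0⟩
    · refine hκ.continuousOn.comp (fun t ht => ?_) fun t ht => (hsub t ht).1
      obtain ⟨h1, h2, h3, h4, -⟩ := hc t (hsub t ht).2
      exact (((continuousAt_extChartAt' h3).comp h1).prodMk
        ((continuousAt_extChartAt' h4).comp h2)).continuousWithinAt
    · exact (hgeo.mono fun t ht => (hsub t ht).2).congr isOpen_Ioo fun t ht => (hjc t ht).symm
    · have hev : (fun t => j (κ (ζ t))) =ᶠ[𝓝 0] c₁ := by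
        filter_upwards [isOpen_Ioo.mem_nhds h0δ] with t ht
        exact hjc t ht
      rw [hjv, ← hv₁]
      simp only [tangentMap]
      rw [hev.mfderiv_eq]
      exact congrArg (fun p => (⟨p, (mfderiv 𝓘(ℝ, ℝ) (𝓡 k) c₁ 0 :
        ℝ →L[ℝ] EuclideanSpace ℝ (Fin k)) 1⟩ : TangentBundle (𝓡 k) N)) hev.self_of_nhds

end Intersection

end RiemSym

/-! ### The index inequality -/

theorem proposition4p7 {n k : ℕ}
    -- the ambient manifold
    (M : Type*) [TopologicalSpace M] [T2Space M] [SecondCountableTopology M]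
    [ChartedSpace (EuclideanSpace ℝ (Fin n)) M] [IsManifold (𝓡 n) ∞ M]
    [RiemannianBundle (fun x : M => TangentSpace (𝓡 n) x)]
    [IsContMDiffRiemannianBundle (𝓡 n) ∞ (EuclideanSpace ℝ (Fin n))
      (fun x : M => TangentSpace (𝓡 n) x)]
    (hsym : RiemSym.IsRiemannianSymmetric (n := n) M)
    (hirr : RiemSym.IsIrreducible (n := n) M)
    -- the submanifold, with its induced Riemannian metric
    (N : Type*) [TopologicalSpace N] [T2Space N] [SecondCountableTopology N] [ConnectedSpace N]
    [ChartedSpace (EuclideanSpace ℝ (Fin k)) N] [IsManifold (𝓡 k) ∞ N]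
    [RiemannianBundle (fun x : N => TangentSpace (𝓡 k) x)]
    [IsContMDiffRiemannianBundle (𝓡 k) ∞ (EuclideanSpace ℝ (Fin k))
      (fun x : N => TangentSpace (𝓡 k) x)]
    (f : N → M) (hf : RiemSym.IsTotallyGeodesicSubmanifold (m := k) (n := n) f)
    (hiso : RiemSym.PreservesMetric (k := k) (n := n) f)
    (hk : 0 < k) (hkn : k < n) :
    RiemSym.index (n := k) N ≤ RiemSym.index (n := n) M := by
  refine le_iInf₂ fun d hd => ?_
  obtain ⟨m, hm, rfl, S, _, _, h, _, _, _, _, hh⟩ := hd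
  obtain ⟨s₀⟩ : Nonempty S := inferInstance
  obtain ⟨q₀⟩ : Nonempty N := inferInstance
  -- by homogeneity, move `S` to a point of `N`
  obtain ⟨φ, hφ, hφs⟩ := RiemSym.exists_isometry_apply_eq hsym (h s₀) (f q₀)
  have hh₁ := hh.map_isometry hφ
  -- by irreducibility, move it further so that `N` is not tangent to it
  let df : TangentSpace (𝓡 k) q₀ →ₗ[ℝ] TangentSpace (𝓡 n) (f q₀) :=
    (mfderiv (𝓡 k) (𝓡 n) f q₀).toLinearMap
  let dh : TangentSpace (𝓡 m) s₀ →ₗ[ℝ] TangentSpace (𝓡 n) (f q₀) :=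
    { toFun := mfderiv (𝓡 m) (𝓡 n) (φ ∘ h) s₀
      map_add' := (mfderiv (𝓡 m) (𝓡 n) (φ ∘ h) s₀).map_add
      map_smul' := (mfderiv (𝓡 m) (𝓡 n) (φ ∘ h) s₀).map_smul }
  have hdf : Function.Injective df := hf.immersion q₀
  have hV : LinearMap.range df ≠ ⊥ := by
    intro hbot
    have h1 : df (EuclideanSpace.single (⟨0, hk⟩ : Fin k) (1 : ℝ)) = 0 := by
      rw [LinearMap.range_eq_bot.1 hbot]; rfl
    have h2 : EuclideanSpace.single (⟨0, hk⟩ : Fin k) (1 : ℝ) = 0 :=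
      (injective_iff_map_eq_zero df).1 hdf _ h1
    simp at h2
  have hW : LinearMap.range dh ≠ ⊤ := by
    intro htop
    have : Module.Finite ℝ (TangentSpace (𝓡 m) s₀) :=
      inferInstanceAs (Module.Finite ℝ (EuclideanSpace ℝ (Fin m)))
    have h1 := LinearMap.finrank_range_le dh
    rw [htop, finrank_top] at h1
    have h2 : Module.finrank ℝ (TangentSpace (𝓡 m) s₀) = m :=
      finrank_euclideanSpace_fin (𝕜 := ℝ) (n := m)
    have h3 : Module.finrank ℝ (TangentSpace (𝓡 n) (f q₀)) = n :=
      finrank_euclideanSpace_fin (𝕜 := ℝ) (n := n)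
    omega
  obtain ⟨ψ, hψ, _, ⟨v, rfl⟩, w, hw, hvw⟩ := RiemSym.exists_isometry_not_mem hirr (f q₀) hV hW
  have hψq : ψ (f q₀) = f q₀ := congrArg TotalSpace.proj hvw
  have hh₂ := hh₁.map_isometry (RiemSym.preservesMetric_diffeomorph_symm hψ)
  have hmeet : f q₀ = (ψ.symm ∘ φ ∘ h) s₀ := by
    change f q₀ = ψ.symm (φ (h s₀))
    rw [hφs, ← hψq, ψ.symm_apply_apply, hψq]
  obtain ⟨D, hD, hdim, j, hj⟩ := RiemSym.exists_totallyGeodesic_inter hf hiso hh₂ hmeet (v₀ := v) (by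
    intro w' hw'
    have e1 := tangentMap_comp_at (⟨s₀, w'⟩ : TangentBundle (𝓡 m) S)
      (ψ.mdifferentiable (by simp) ((ψ.symm ∘ φ ∘ h) s₀))
      (hh₂.contMDiff.mdifferentiable (by simp) s₀)
    have e2 : ψ ∘ (ψ.symm ∘ φ ∘ h) = φ ∘ h := funext fun s => ψ.apply_symm_apply _
    rw [e2, ← hw'] at e1
    have e3 := e1.trans hvw
    exact hw ⟨w', eq_of_heq (TotalSpace.mk.inj e3).2⟩)
  refine iInf₂_le_of_le (k - D) ⟨D, hD, rfl, EuclideanSpace ℝ (Fin D), inferInstance,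
    inferInstance, j, inferInstance, inferInstance, inferInstance, inferInstance, hj⟩ ?_
  exact_mod_cast (by omega : k - D ≤ n - m)
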